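/- Let $X=\{0,1\}$, let $X^*$ be the set of finite words over $X$, viewed as the vertices of the infinite rooted binary tree, and let $\mathrm{Aut}\,X^*$ be its automorphism group. For $g\in\mathrm{Aut}\,X^*$ fixing the two vertices of the first level, write $\psi(g)=(g_0,g_1)$ if $g(xw)=x\,g_x(w)$ for $x\in X$, $w\in X^*$. Let $a$ be the automorphism that exchanges the two maximal subtrees ($0w\leftrightarrow 1w$), and define automorphisms $\beta,\gamma,\delta$ recursively by $$\psi(\beta)=(\gamma,a),\qquad \psi(\gamma)=(a,\delta),\qquad \psi(\delta)=(1,\beta).$$ Let $G=\langle a,\beta,\gamma,\delta\rangle\le\mathrm{Aut}\,X^*$, let $K$ be the normal closure in $G$ of $\{[a,\beta],[\beta,\gamma],[\beta,\delta],[\gamma,\delta],\beta\gamma\delta\}$, and let $C\le G$ be the subgroup generated by $[K,G]$ and $[a,\beta][\beta,\gamma]$. For a word $v$ and $g\in\mathrm{Aut}\,X^*$ let $v*g$ be the automorphism with $(v*g)(vu)=v\,g(u)$ for every word $u$, fixing every word that does not have $v$ as a prefix; for $H\le\mathrm{Aut}\,X^*$ put $v*H=\{v*h:h\in H\}$ and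 $X^n*H=\prod_{v\in X^n}v*H$. Then: 1. $C$ has index $64$ in $G$. 2. For every non-trivial normal subgroup $N$ of $G$ there is $n_0$ such that $X^n*C\le N$ for all $n\ge n_0$. 3. Every $X^n*C$ ($n\ge0$) is a normal subgroup of finite index of $G$, and the subgroups $X^n*C$, $n\ge0$, form a basis of neighbourhoods of the identity for the profinite topology of $G$ (the topology generated by the cosets of the normal subgroups of finite index of $G$). -/

import Mathlib

open scoped commutatorElement

/-- `Aut X*`: the automorphism group of the infinite rooted binary tree. The vertices are the finite
words over the alphabet `X = {0, 1}` (`false` is `0`, `true` is `1`), `u` being an ancestor of `v`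
when `u` is a prefix of `v`. The product is composition. -/
abbrev TreeAut : Type :=
  ((· <+: ·) : List Bool → List Bool → Prop) ≃r ((· <+: ·) : List Bool → List Bool → Prop)

namespace TwistedTwin

/-- The automorphism given by an involution of the set of words that respects prefixes. -/
def ofInvolutive (f : List Bool → List Bool) (hf : Function.Involutive f)
    (hp : ∀ u v, u <+: v → f u <+: f v) : TreeAut where
  toEquiv := hf.toPerm f
  map_rel_iff' := by
    intro u v
    refine ⟨fun h => ?_, hp u v⟩
    have h' := hp _ _ h
    simpa [hf u, hf v] using h'

/-- Names of the four generators `a, β, γ, δ`. -/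
inductive Gen
  | a | β | γ | δ

/-- The action of the generators on words: `a` exchanges the two maximal subtrees, and
`ψ(β) = (γ, a)`, `ψ(γ) = (a, δ)`, `ψ(δ) = (1, β)`. -/
def Gen.act : Gen → List Bool → List Bool
  | _, [] => []
  | .a, x :: w => (!x) :: w
  | .β, false :: w => false :: Gen.act .γ w
  | .β, true :: w => true :: Gen.act .a w
  | .γ, false :: w => false :: Gen.act .a w
  | .γ, true :: w => true :: Gen.act .δ w
  | .δ, false :: w => false :: w
  | .δ, true :: w => true :: Gen.act .β w

theorem Gen.act_involutive (s : Gen) : Function.Involutive s.act := by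
  intro w
  induction w generalizing s with
  | nil => cases s <;> rfl
  | cons x w ih => cases s <;> cases x <;> simp [Gen.act, ih]

theorem Gen.act_prefix (s : Gen) (u v : List Bool) (h : u <+: v) : s.act u <+: s.act v := by
  induction u generalizing s v with
  | nil => cases s <;> simp [Gen.act]
  | cons x u ih =>
    obtain ⟨t, rfl⟩ := h
    have ih' : ∀ s : Gen, s.act u <+: s.act (u ++ t) := fun s => ih s _ (List.prefix_append u t)
    cases s <;> cases x <;> simp [Gen.act, ih']

/-- The generators as automorphisms of the tree. -/
def Gen.toAut (s : Gen) : TreeAut := ofInvolutive s.act s.act_involutive s.act_prefix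

/-- The twisted twin `G` of the Grigorchuk group: the group generated by `a, β, γ, δ`. -/
def G : Subgroup TreeAut := Subgroup.closure (Set.range Gen.toAut)

/-- The generators as elements of `G`. -/
def gen (s : Gen) : G := ⟨s.toAut, Subgroup.subset_closure ⟨s, rfl⟩⟩

/-- The generator `a` of `G`. -/
def a : G := gen .a

/-- The generator `β` of `G`. -/
def β : G := gen .β

/-- The generator `γ` of `G`. -/
def γ : G := gen .γ

/-- The generator `δ` of `G`. -/
def δ : G := gen .δ

/-- The normal closure `K` in `G` of `[a,β], [β,γ], [β,δ], [γ,δ], βγδ`. -/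
def K : Subgroup G :=
  Subgroup.normalClosure {⁅a, β⁆, ⁅β, γ⁆, ⁅β, δ⁆, ⁅γ, δ⁆, β * γ * δ}

/-- The subgroup `C` of `G` generated by `[K, G]` and `[a,β][β,γ]`. -/
def C : Subgroup G :=
  ⁅K, (⊤ : Subgroup G)⁆ ⊔ Subgroup.closure {⁅a, β⁆ * ⁅β, γ⁆}

/-- The action of `v * g` on words: `v u ↦ v g(u)`, and words without prefix `v` are fixed. -/
def translateFun (v : List Bool) (g : TreeAut) (u : List Bool) : List Bool :=
  if v <+: u then v ++ g (u.drop v.length) else u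

theorem translateFun_append (v : List Bool) (g : TreeAut) (u : List Bool) :
    translateFun v g (v ++ u) = v ++ g u := by
  simp [translateFun]

theorem translateFun_of_not (v : List Bool) (g : TreeAut) (u : List Bool) (h : ¬ v <+: u) :
    translateFun v g u = u := by
  simp [translateFun, h]

theorem translateFun_mul (v : List Bool) (g h : TreeAut) (u : List Bool) :
    translateFun v (g * h) u = translateFun v g (translateFun v h u) := by
  by_cases hu : v <+: u
  · obtain ⟨t, rfl⟩ := hu
    simp only [translateFun_append, RelIso.mul_apply]
  · simp only [translateFun_of_not v _ u hu]

theorem translateFun_one (v : List Bool) (u : List Bool) :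
    translateFun v (1 : TreeAut) u = u := by
  by_cases hu : v <+: u
  · obtain ⟨t, rfl⟩ := hu
    simp only [translateFun_append, RelIso.one_apply]
  · exact translateFun_of_not v _ u hu

theorem translateFun_prefix (v : List Bool) (g : TreeAut) (u w : List Bool) (h : u <+: w) :
    translateFun v g u <+: translateFun v g w := by
  by_cases hu : v <+: u
  · obtain ⟨t, rfl⟩ := hu
    obtain ⟨s, rfl⟩ := h
    rw [List.append_assoc, translateFun_append, translateFun_append, List.prefix_append_right_inj]
    exact g.map_rel_iff.2 (List.prefix_append t s)
  · rw [translateFun_of_not v g u hu]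
    by_cases hw : v <+: w
    · have huv : u <+: v := (List.prefix_or_prefix_of_prefix h hw).resolve_right hu
      obtain ⟨s, rfl⟩ := hw
      rw [translateFun_append]
      exact huv.trans (List.prefix_append v _)
    · rwa [translateFun_of_not v g w hw]

/-- The translation `g ↦ v * g` as a group homomorphism `Aut X* → Aut X*`: `v * g` acts like `g` on
the subtree below `v` and trivially elsewhere. -/
def translate (v : List Bool) : TreeAut →* TreeAut where
  toFun g :=
    { toFun := translateFun v g
      invFun := translateFun v g⁻¹
      left_inv := fun u => by rw [← translateFun_mul, inv_mul_cancel, translateFun_one]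
      right_inv := fun u => by rw [← translateFun_mul, mul_inv_cancel, translateFun_one]
      map_rel_iff' := by
        intro u w
        refine ⟨fun h => ?_, translateFun_prefix v g u w⟩
        have h' := translateFun_prefix v g⁻¹ _ _ h
        simpa [← translateFun_mul, translateFun_one] using h' }
  map_one' := RelIso.ext fun u => translateFun_one v u
  map_mul' g h := RelIso.ext fun u => translateFun_mul v g h u

/-- `X^n * H`: the product of the subgroups `v * H`, `v` ranging over the words of length `n`. -/
def levelProd (n : ℕ) (H : Subgroup TreeAut) : Subgroup TreeAut :=
  ⨆ (v : List Bool) (_ : v.length = n), H.map (translate v)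

/-- The subgroup `X^n * C` of `Aut X*`. -/
def XC (n : ℕ) : Subgroup TreeAut := levelProd n (C.map G.subtype)

/-- The profinite topology of a group: the open sets are generated by the (left) cosets of the
normal subgroups of finite index. -/
@[reducible]
def profiniteTopology (Γ : Type*) [Group Γ] : TopologicalSpace Γ :=
  TopologicalSpace.generateFrom
    {S | ∃ (N : Subgroup Γ) (g : Γ), N.Normal ∧ N.FiniteIndex ∧ S = (fun x => g * x) '' (N : Set Γ)}

end TwistedTwin

namespace TwistedTwin

/-! `G` is self-replicating and branches over `K`: a copy of `K` placed below a vertex of the first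
level lies in `K` again (`K_le_below_K`). For the element `[a,β][β,γ]` more is true. It lifts to
`[γ,aδa][aδa,β]`, and modulo `[K,G]` the element `βγδ` is central while `δ` commutes with `aδa`, so
`[γ,aδa]` and `[β,aδa]` agree and the lift vanishes. Hence `C` placed one level down is already in
`[K,G]` (`C_le_below_KG`). Three levels further down `[K,G]` falls into `[K,K]`, because the
sections of elements of `K` generate `G` after three projections (`relCentralizer_third_eq_top`).

Index, upper bound: in `G/C` the element `z = βγδ` is central with `z^4 = 1`, and adjoining `β`,
`δ`, `aδa`, `a` in turn at most doubles the group each time, giving `4 * 2^4`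
(`encard_closure_le_of_central`). Lower bound: `G` acts transitively on 64 values of invariants
modulo 2 of words, and `C` acts trivially (`dvd_index_C`). The action is well defined because words
trivial on the tree have trivial invariants; this follows from contraction, as sections on the third
level have about half the weight (`weight_secAt_le`, `TrivialWord.invt`).

Normal subgroups: some section of a nontrivial element of `N` swaps the two subtrees, and a double
commutator with it puts a copy of `[K,K]` into `N` (`exists_commutator_K_le`). Four more levels
bring `C` into that copy. Since `G` is infinite, normal subgroups of finite index are nontrivial, so
the `X^n * C` form a basis. -/

/-! ### Words in the generators and their sections -/

/-- The action on the tree of a word in the generators. -/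
def wordAct (w : List Gen) (v : List Bool) : List Bool := w.foldr Gen.act v

@[simp] theorem wordAct_nil (v : List Bool) : wordAct [] v = v := rfl

@[simp] theorem wordAct_cons (s : Gen) (w : List Gen) (v : List Bool) :
    wordAct (s :: w) v = s.act (wordAct w v) := rfl

theorem wordAct_append (u w : List Gen) (v : List Bool) :
    wordAct (u ++ w) v = wordAct u (wordAct w v) := by simp [wordAct]

theorem wordAct_root (w : List Gen) : wordAct w [] = [] := by
  induction w with
  | nil => rfl
  | cons s w ih => cases s <;> simp [ih, Gen.act]

/-- The section of a generator at a vertex of the first level, as a word. -/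
def Gen.sec : Bool → Gen → List Gen
  | _, .a => []
  | false, .β => [.γ]
  | true, .β => [.a]
  | false, .γ => [.a]
  | true, .γ => [.δ]
  | false, .δ => []
  | true, .δ => [.β]

/-- Whether a generator exchanges the two vertices of the first level. -/
def Gen.swaps : Gen → Bool
  | .a => true
  | _ => false

/-- Whether a word exchanges the two vertices of the first level. -/
def wordSwaps : List Gen → Bool
  | [] => false
  | s :: w => s.swaps ^^ wordSwaps w

/-- The section of a word at a vertex of the first level. -/
def wordSec (x : Bool) : List Gen → List Gen
  | [] => []
  | s :: w => s.sec (x ^^ wordSwaps w) ++ wordSec x w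

theorem Gen.act_cons (s : Gen) (x : Bool) (v : List Bool) :
    s.act (x :: v) = (x ^^ s.swaps) :: wordAct (s.sec x) v := by
  cases s <;> cases x <;> simp [Gen.act, Gen.sec, Gen.swaps]

theorem wordAct_vertex (w : List Gen) (x : Bool) (v : List Bool) :
    wordAct w (x :: v) = (x ^^ wordSwaps w) :: wordAct (wordSec x w) v := by
  induction w with
  | nil => simp [wordSwaps, wordSec]
  | cons s w ih =>
    rw [wordAct_cons, ih, Gen.act_cons, wordSec, wordAct_append, wordSwaps, Bool.xor_assoc,
      Bool.xor_comm (wordSwaps w)]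

theorem wordSwaps_append (u w : List Gen) :
    wordSwaps (u ++ w) = (wordSwaps u ^^ wordSwaps w) := by
  induction u with
  | nil => simp [wordSwaps]
  | cons s u ih => simp [wordSwaps, ih]

theorem wordSec_append (x : Bool) (u w : List Gen) :
    wordSec x (u ++ w) = wordSec (x ^^ wordSwaps w) u ++ wordSec x w := by
  induction u with
  | nil => simp [wordSec]
  | cons s u ih =>
    simp only [List.cons_append, wordSec, ih, wordSwaps_append, List.append_assoc]
    congr 2
    cases x <;> cases wordSwaps u <;> cases wordSwaps w <;> rfl

/-- The section of a word at an arbitrary vertex. -/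
def wordSecAt : List Bool → List Gen → List Gen
  | [], w => w
  | x :: v, w => wordSecAt v (wordSec x w)

theorem wordSecAt_append (v : List Bool) (u w : List Gen) :
    wordSecAt v (u ++ w) = wordSecAt (wordAct w v) u ++ wordSecAt v w := by
  induction v generalizing u w with
  | nil => rw [wordAct_root]; rfl
  | cons x v ih => rw [wordAct_vertex]; simp only [wordSecAt, wordSec_append, ih]

/-- A word is trivial on the tree. -/
def TrivialWord (w : List Gen) : Prop := ∀ v, wordAct w v = v

theorem TrivialWord.swaps {w : List Gen} (h : TrivialWord w) : wordSwaps w = false := by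
  have := h [false]
  rw [wordAct_vertex] at this
  simpa using (List.cons.inj this).1

theorem TrivialWord.sec {w : List Gen} (h : TrivialWord w) (x : Bool) :
    TrivialWord (wordSec x w) := by
  intro v
  have := h (x :: v)
  rw [wordAct_vertex] at this
  exact (List.cons.inj this).2

/-! ### Contraction on the third level -/

/-- The number of letters different from `a`. -/
def weight : List Gen → ℕ
  | [] => 0
  | s :: w => (if s.swaps then 0 else 1) + weight w

theorem weight_append (u w : List Gen) : weight (u ++ w) = weight u + weight w := by
  induction u with
  | nil => simp [weight]
  | cons s u ih => simp [weight, ih, add_assoc]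

/-- The vertex of the third level at which the section of a generator other than `a` is that
generator. -/
def Gen.ray : Gen → List Bool
  | .a => []
  | .β => [false, true, true]
  | .γ => [true, true, false]
  | .δ => [true, false, true]

instance : DecidableEq Gen := fun s t => by
  cases s <;> cases t <;> first | exact isTrue rfl | exact isFalse (by simp)

instance : Fintype Gen := ⟨{.a, .β, .γ, .δ}, fun s => by cases s <;> decide⟩

/-- The sections run through the cycle `β → γ → δ → β` along the ray; every other branch ends in `a`
or `1` within three levels. -/
theorem Gen.weight_secAt (s : Gen) (x y z : Bool) :
    weight (wordSecAt [x, y, z] [s]) = if s.ray = [x, y, z] then 1 else 0 := by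
  revert s x y z; decide

theorem length_wordAct (w : List Gen) (v : List Bool) : (wordAct w v).length = v.length := by
  induction v generalizing w with
  | nil => simp [wordAct_root]
  | cons x v ih => simp [wordAct_vertex, ih]

/-- A word of which no two consecutive letters are equal. -/
def Reduced (w : List Gen) : Prop := w.IsChain (· ≠ ·)

/-- A letter `s ≠ a` contributes at a vertex only if the suffix after it moves the vertex to
`s.ray`. Rays of distinct letters differ and `a` moves no ray to a ray, so two successive letters
other than `a` never both contribute. The second alternative keeps track of the case in which the
leftmost such letter may have contributed. -/
theorem weight_secAt_aux (x y z : Bool) (w : List Gen) (h : Reduced w) :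
    2 * weight (wordSecAt [x, y, z] w) ≤ weight w ∨
    2 * weight (wordSecAt [x, y, z] w) ≤ weight w + 1 ∧ ∃ t : Gen, t ≠ .a ∧
      (w.head? = some t ∧ wordAct w [x, y, z] = t.ray ∨
       w.head? = some .a ∧ wordAct w [x, y, z] = Gen.act .a t.ray) := by
  induction w with
  | nil => left; cases x <;> cases y <;> cases z <;> decide
  | cons s w ih =>
    have hw : Reduced w := List.IsChain.of_cons h
    have hs : ∀ t, w.head? = some t → s ≠ t := by
      intro t ht
      cases w with
      | nil => simp at ht
      | cons t' w => simp at ht; subst ht; exact (List.isChain_cons_cons.1 h).1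
    have key : weight (wordSecAt [x, y, z] (s :: w)) =
        (if s.ray = wordAct w [x, y, z] then 1 else 0) + weight (wordSecAt [x, y, z] w) := by
      rw [← List.singleton_append (x := s), wordSecAt_append, weight_append]
      have := length_wordAct w [x, y, z]
      obtain ⟨x', y', z', e⟩ : ∃ x' y' z', wordAct w [x, y, z] = [x', y', z'] := by
        rwa [List.length_cons, List.length_cons, List.length_singleton, List.length_eq_three] at this
      rw [e, Gen.weight_secAt]
    rw [key, weight]
    by_cases hsa : s = .a
    · subst hsa
      have hr : Gen.ray .a ≠ wordAct w [x, y, z] := by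
        intro e
        have := length_wordAct w [x, y, z]
        rw [← e] at this
        simp [Gen.ray] at this
      rw [if_neg hr]
      simp only [Gen.swaps, if_true, zero_add]
      rcases ih hw with h1 | ⟨h1, t, ht, ⟨h2, h3⟩ | ⟨h2, h3⟩⟩
      · exact .inl h1
      · exact .inr ⟨h1, t, ht, .inr ⟨rfl, by rw [wordAct_cons, h3]⟩⟩
      · exact absurd rfl (hs _ h2)
    · have hsw : s.swaps = false := by cases s <;> simp_all [Gen.swaps]
      have hray : s.act s.ray = s.ray := by cases s <;> simp_all [Gen.ray, Gen.act]
      simp only [hsw, Bool.false_eq_true, if_false]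
      rcases ih hw with h1 | ⟨h1, t, ht, ⟨h2, h3⟩ | ⟨h2, h3⟩⟩
      · split_ifs with hr
        · exact .inr ⟨by omega, s, hsa, .inl ⟨rfl, by rw [wordAct_cons, ← hr, hray]⟩⟩
        · left; omega
      · have : s.ray ≠ t.ray := by
          have := hs _ h2
          clear * - this hsa ht
          revert s t; decide
        rw [h3, if_neg this]; left; omega
      · have : s.ray ≠ Gen.act .a t.ray := by
          clear * - hsa ht
          revert s t; decide
        rw [h3, if_neg this]; left; omega

theorem weight_secAt_le (x y z : Bool) {w : List Gen} (h : Reduced w) :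
    2 * weight (wordSecAt [x, y, z] w) ≤ weight w + 1 := by
  rcases weight_secAt_aux x y z w h with h | ⟨h, -⟩ <;> omega

/-- The vertices of the fourth level. -/
def fourthLevel : List (List Bool) := do
  let x ← [false, true]
  let y ← [false, true]
  let z ← [false, true]
  let t ← [false, true]
  return [x, y, z, t]

/-- The words that act trivially and contain at most one letter different from `a` are, if reduced,
empty. -/
theorem TrivialWord.eq_nil {w : List Gen} (h : TrivialWord w) (hr : Reduced w)
    (hw : weight w ≤ 1) : w = [] := by
  -- The fourth level detects all nonempty reduced words of length at most three and weight at most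
  -- one. A reduced word has no two adjacent `a`, so four letters already have weight two.
  have e1 : ∀ s : Gen, ∃ v ∈ fourthLevel, wordAct [s] v ≠ v := by decide
  have e2 : ∀ s t : Gen, s ≠ t → weight [s, t] ≤ 1 → ∃ v ∈ fourthLevel, wordAct [s, t] v ≠ v := by
    decide
  have e3 : ∀ s t r : Gen, s ≠ t → t ≠ r → weight [s, t, r] ≤ 1 →
      ∃ v ∈ fourthLevel, wordAct [s, t, r] v ≠ v := by decide
  have e4 : ∀ s t r q : Gen, s ≠ t → t ≠ r → r ≠ q →
      2 ≤ (if s.swaps then 0 else 1) + ((if t.swaps then 0 else 1) +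
        ((if r.swaps then 0 else 1) + (if q.swaps then 0 else 1))) := by decide
  match w, hr, hw with
  | [], _, _ => rfl
  | [s], _, _ =>
    obtain ⟨v, -, hv⟩ := e1 s
    exact absurd (h v) hv
  | [s, t], hr, hw =>
    simp only [Reduced, List.isChain_cons_cons] at hr
    obtain ⟨v, -, hv⟩ := e2 s t hr.1 hw
    exact absurd (h v) hv
  | [s, t, r], hr, hw =>
    simp only [Reduced, List.isChain_cons_cons] at hr
    obtain ⟨v, -, hv⟩ := e3 s t r hr.1 hr.2.1 hw
    exact absurd (h v) hv
  | s :: t :: r :: q :: w, hr, hw =>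
    simp only [Reduced, List.isChain_cons_cons] at hr
    have := e4 s t r q hr.1 hr.2.1 hr.2.2.1
    simp only [weight] at hw
    omega

/-- Cancels squares of letters. -/
def reduceWord : List Gen → List Gen
  | [] => []
  | s :: w =>
    match reduceWord w with
    | [] => [s]
    | t :: u => if s = t then u else s :: t :: u

theorem reduced_reduceWord (w : List Gen) : Reduced (reduceWord w) := by
  induction w with
  | nil => exact List.isChain_nil
  | cons s w ih =>
    rw [reduceWord]
    split
    · exact List.isChain_singleton s
    · next t u e =>
      rw [e] at ih
      split_ifs with h
      · exact List.IsChain.of_cons ih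
      · exact List.isChain_cons_cons.2 ⟨h, ih⟩

theorem weight_reduceWord_le (w : List Gen) : weight (reduceWord w) ≤ weight w := by
  induction w with
  | nil => exact le_rfl
  | cons s w ih =>
    rw [reduceWord]
    split
    · next e => simp [weight]
    · next t u e =>
      rw [e] at ih
      split_ifs with h
      · simp only [weight] at ih ⊢; omega
      · simp only [weight] at ih ⊢; omega

/-- Evaluation of a word by letters that act by involutions is not changed by the reduction. -/
theorem foldr_reduceWord {α : Type*} (f : Gen → α → α) (hf : ∀ s, Function.Involutive (f s))
    (w : List Gen) (x : α) : (reduceWord w).foldr f x = w.foldr f x := by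
  induction w with
  | nil => rfl
  | cons s w ih =>
    rw [reduceWord]
    split
    · next e => rw [e] at ih; simp [← ih]
    · next t u e =>
      rw [e] at ih
      split_ifs with h
      · rw [List.foldr_cons, ← ih, h, List.foldr_cons, hf]
      · simp [← ih]

/-! ### Invariants modulo 2 of words -/

/-- The parities of the numbers of occurrences of the four generators in a word, and a quadratic
correction term (`phase`) that distinguishes the central elements of the Pauli group. -/
@[ext] structure Invt where
  a : Bool
  b : Bool
  c : Bool
  d : Bool
  phase : Bool
deriving DecidableEq, Fintype

/-- The invariants of the empty word. -/
def Invt.zero : Invt := ⟨false, false, false, false, false⟩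

/-- The effect on the invariants of putting a letter in front of a word. -/
def Gen.updInvt : Gen → Invt → Invt
  | .a, ⟨i, j, k, l, h⟩ => ⟨!i, j, k, l, h ^^ (j ^^ k)⟩
  | .β, ⟨i, j, k, l, h⟩ => ⟨i, !j, k, l, h⟩
  | .γ, ⟨i, j, k, l, h⟩ => ⟨i, j, !k, l, h ^^ j⟩
  | .δ, ⟨i, j, k, l, h⟩ => ⟨i, j, k, !l, h ^^ (j ^^ k)⟩

/-- The invariants of a word. -/
def invt (w : List Gen) : Invt := w.foldr Gen.updInvt Invt.zero

theorem invt_cons (s : Gen) (w : List Gen) : invt (s :: w) = s.updInvt (invt w) := rfl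

theorem Gen.updInvt_involutive (s : Gen) : Function.Involutive s.updInvt := by
  rintro ⟨i, j, k, l, h⟩
  revert s i j k l h; decide

/-- The invariants of a word are determined by those of its sections. -/
structure Invt.Sections (t p q : Invt) : Prop where
  q_a : q.a = (p.c ^^ p.d)
  p_a : p.a = (q.c ^^ q.d)
  b : t.b = (p.c ^^ q.c)
  c : t.c = (p.d ^^ q.d)
  d : t.d = (p.b ^^ q.b)
  phase : t.phase = (p.d ^^ p.phase ^^ q.c ^^ q.phase ^^ (p.a && p.b) ^^ (p.a && q.b) ^^
    (p.a && t.a) ^^ (p.b && p.c) ^^ (p.b && p.d) ^^ (p.c && q.b) ^^ (p.c && q.c) ^^ (p.c && t.a) ^^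
    (p.d && q.b) ^^ (p.d && t.a))

theorem invt_a (w : List Gen) : (invt w).a = wordSwaps w := by
  induction w with
  | nil => rfl
  | cons s w ih => rw [invt_cons, wordSwaps, ← ih]; cases s <;> simp [Gen.updInvt, Gen.swaps]

/-- The section of `s w` at `0` begins with the section of `s` at the image of `0` under `w`, and
that image is the bit `t.a`. -/
theorem Invt.Sections.upd {t p q : Invt} (h : t.Sections p q) (s : Gen) :
    (s.updInvt t).Sections ((s.sec t.a).foldr Gen.updInvt p)
      ((s.sec (!t.a)).foldr Gen.updInvt q) := by
  obtain ⟨ta, tb, tc, td, th⟩ := t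
  obtain ⟨pa, pb, pc, pd, ph⟩ := p
  obtain ⟨qa, qb, qc, qd, qh⟩ := q
  obtain ⟨h1, h2, h3, h4, h5, h6⟩ := h
  dsimp only at h1 h2 h3 h4 h5 h6
  subst h1 h3 h4 h5 h6
  cases s <;> cases ta <;> constructor <;>
    simp only [Gen.updInvt, Gen.sec, List.foldr_cons, List.foldr_nil, Bool.not_true,
      Bool.not_false] <;>
    subst h2 <;> revert pb pc pd ph qb qc qd qh <;> decide

theorem invt_sections (w : List Gen) :
    (invt w).Sections (invt (wordSec false w)) (invt (wordSec true w)) := by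
  induction w with
  | nil => constructor <;> rfl
  | cons s w ih =>
    have := ih.upd s
    rw [invt_a] at this
    simp only [invt, wordSec, List.foldr_append, Bool.false_xor, Bool.true_xor]
    exact this

theorem invt_eq_zero_of_sections {w : List Gen} (h : wordSwaps w = false)
    (h0 : invt (wordSec false w) = Invt.zero) (h1 : invt (wordSec true w) = Invt.zero) :
    invt w = Invt.zero := by
  have := invt_sections w
  rw [h0, h1] at this
  rw [← invt_a] at h
  obtain ⟨-, -, e1, e2, e3, e4⟩ := this
  rw [h] at e4
  exact Invt.ext h e1 e2 e3 e4

theorem TrivialWord.secAt {w : List Gen} (h : TrivialWord w) (v : List Bool) :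
    TrivialWord (wordSecAt v w) := by
  induction v generalizing w with
  | nil => exact h
  | cons x v ih => exact ih (h.sec x)

theorem TrivialWord.invt_of_level {n : ℕ} {w : List Gen} (h : TrivialWord w)
    (hn : ∀ v : List Bool, v.length = n → invt (wordSecAt v w) = Invt.zero) :
    invt w = Invt.zero := by
  induction n generalizing w with
  | zero => exact hn [] rfl
  | succ n ih =>
    have : ∀ x, invt (wordSec x w) = Invt.zero := fun x =>
      ih (h.sec x) fun v hv => hn (x :: v) (by simp [hv])
    exact invt_eq_zero_of_sections h.swaps (this _) (this _)

/-- A word that acts trivially on the tree has trivial invariants. -/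
theorem TrivialWord.invt {w : List Gen} (h : TrivialWord w) : invt w = Invt.zero := by
  induction hn : weight w using Nat.strong_induction_on generalizing w with
  | _ n ih =>
    subst hn
    have hr := reduced_reduceWord w
    have hle := weight_reduceWord_le w
    have e : TwistedTwin.invt (reduceWord w) = TwistedTwin.invt w :=
      foldr_reduceWord _ Gen.updInvt_involutive w _
    have ht : TrivialWord (reduceWord w) := fun v => by
      rw [wordAct, foldr_reduceWord _ Gen.act_involutive]; exact h v
    rw [← e]
    -- From `2 w' ≤ w + 1` follows `w' < w` only when `w ≥ 2`; smaller weights are settled by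
    -- `eq_nil`.
    by_cases h1 : weight (reduceWord w) ≤ 1
    · rw [ht.eq_nil hr h1]; rfl
    · refine ht.invt_of_level (n := 3) fun v hv => ?_
      obtain ⟨x, y, z, rfl⟩ := List.length_eq_three.1 hv
      have := weight_secAt_le x y z hr
      exact ih _ (by omega) (ht.secAt _) rfl

/-! ### The action of `G` on 64 values -/

/-- The effect of putting a letter in front of a word on the invariants of the word, extended by
the parity of the number of letters `β` and `δ` in the section at the vertex `0`. -/
def Gen.updExt (s : Gen) (t : Invt × Bool) : Invt × Bool :=
  (s.updInvt t.1, match s with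
    | .a => t.2
    | .β => t.2
    | .γ => t.2 ^^ t.1.a
    | .δ => t.2 ^^ t.1.a)

theorem Gen.updExt_involutive (s : Gen) : Function.Involutive s.updExt := by
  rintro ⟨⟨i, j, k, l, h⟩, u⟩
  revert s i j k l h u; decide

theorem foldr_updExt (w : List Gen) : w.foldr Gen.updExt (Invt.zero, false) =
    (invt w, (invt (wordSec false w)).b ^^ (invt (wordSec false w)).d) := by
  induction w with
  | nil => rfl
  | cons s w ih =>
    rw [List.foldr_cons, ih, invt_cons, wordSec, Bool.false_xor, ← invt_a]
    refine Prod.ext rfl ?_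
    simp only [invt, List.foldr_append, Gen.updExt]
    generalize List.foldr Gen.updInvt Invt.zero (wordSec false w) = p
    generalize (List.foldr Gen.updInvt Invt.zero w).a = x
    obtain ⟨i, j, k, l, h⟩ := p
    revert s i j k l h x; decide

/-- Every value of the extended invariants is attained. -/
theorem exists_foldr_updExt (t : Invt × Bool) :
    ∃ w : List Gen, w.foldr Gen.updExt (Invt.zero, false) = t := by
  obtain ⟨⟨i, j, k, l, h⟩, u⟩ := t
  -- The word `a^i β^j γ^k δ^l` has the required parities and phase `i && (j ^^ k)`. The factors
  -- `[β,γ]` and `[a,δ]` flip only the phase and only the last bit.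
  refine ⟨(if i then [.a] else []) ++ (if j then [.β] else []) ++ (if k then [.γ] else []) ++
    (if l then [.δ] else []) ++ (if h ^^ (i && (j ^^ k)) then [.β, .γ, .β, .γ] else []) ++
    (if u then [.a, .δ, .a, .δ] else []), ?_⟩
  revert i j k l h u; decide

/-- The vanishing of invariants controls only the base point. Any other value is reached by a word
`u`, and applying the base point case to the trivial word `u⁻¹ w u` transports the result. -/
theorem TrivialWord.foldr_updExt {w : List Gen} (h : TrivialWord w) (t : Invt × Bool) :
    w.foldr Gen.updExt t = t := by
  obtain ⟨u, rfl⟩ := exists_foldr_updExt t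
  have hrev : ∀ (α : Type) (f : Gen → α → α) (_ : ∀ s, Function.Involutive (f s)) (u : List Gen)
      (x : α), u.reverse.foldr f (u.foldr f x) = x := by
    intro α f hf u x
    induction u with
    | nil => rfl
    | cons s u ih => simp only [List.reverse_cons, List.foldr_append, List.foldr_cons,
        List.foldr_nil, hf s _, ih]
  have hrev' : ∀ (α : Type) (f : Gen → α → α) (_ : ∀ s, Function.Involutive (f s)) (u : List Gen)
      (x : α), u.foldr f (u.reverse.foldr f x) = x := by
    intro α f hf u x
    simpa using hrev α f hf u.reverse x
  have ht : TrivialWord (u.reverse ++ w ++ u) := by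
    intro v
    rw [wordAct_append, wordAct_append, h]
    exact hrev _ _ Gen.act_involutive u v
  have e := TwistedTwin.foldr_updExt (u.reverse ++ w ++ u)
  rw [ht.invt, (ht.sec false).invt, List.foldr_append, List.foldr_append] at e
  have e' := congrArg (List.foldr Gen.updExt · u) e
  simp only [hrev' _ _ Gen.updExt_involutive] at e'
  exact e'

/-- The action of the free group on the values of the extended invariants. -/
def freeExt : FreeGroup Gen →* Equiv.Perm (Invt × Bool) :=
  FreeGroup.lift fun s => s.updExt_involutive.toPerm

/-- The projection of the free group to `G`. -/
def freeProj : FreeGroup Gen →* G := FreeGroup.lift gen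

theorem freeProj_surjective : Function.Surjective freeProj := by
  have h : G ≤ ((G.subtype).comp freeProj).range := by
    refine (Subgroup.closure_le _).2 ?_
    rintro _ ⟨s, rfl⟩
    exact ⟨FreeGroup.of s, by simp [freeProj, gen]⟩
  intro g
  obtain ⟨x, hx⟩ := h g.2
  exact ⟨x, Subtype.ext hx⟩

theorem exists_word (x : FreeGroup Gen) : ∃ w : List Gen,
    (∀ v, (freeProj x : TreeAut) v = wordAct w v) ∧ ∀ t, freeExt x t = w.foldr Gen.updExt t := by
  induction x using FreeGroup.induction_on with
  | C1 => exact ⟨[], fun v => by simp, fun t => by simp⟩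
  | of s => exact ⟨[s], fun v => by simp [freeProj, gen]; rfl, fun t => by simp [freeExt]⟩
  | inv_of s _ =>
    refine ⟨[s], fun v => ?_, fun t => ?_⟩
    · simp only [map_inv, freeProj, FreeGroup.lift_apply_of]; rfl
    · simp only [map_inv, freeExt, FreeGroup.lift_apply_of]; rfl
  | mul x y hx hy =>
    obtain ⟨u, hu, hu'⟩ := hx
    obtain ⟨w, hw, hw'⟩ := hy
    refine ⟨u ++ w, fun v => ?_, fun t => ?_⟩
    · rw [map_mul, wordAct_append, ← hw, ← hu]; rfl
    · rw [map_mul, List.foldr_append, ← hw', ← hu']; rfl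

theorem ker_freeProj_le : freeProj.ker ≤ freeExt.ker := by
  intro x hx
  obtain ⟨w, hw, hw'⟩ := exists_word x
  have ht : TrivialWord w := fun v => by
    rw [← hw, MonoidHom.mem_ker.1 hx]; rfl
  exact MonoidHom.mem_ker.2 (Equiv.ext fun t => by rw [hw', ht.foldr_updExt]; rfl)

/-- The action of `G` on the values of the extended invariants. -/
noncomputable def actExt : G →* Equiv.Perm (Invt × Bool) :=
  freeProj.liftOfSurjective freeProj_surjective ⟨freeExt, ker_freeProj_le⟩

theorem actExt_freeProj (x : FreeGroup Gen) : actExt (freeProj x) = freeExt x :=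
  freeProj.liftOfRightInverse_comp_apply _ _ ⟨freeExt, ker_freeProj_le⟩ x

theorem actExt_gen (s : Gen) (t : Invt × Bool) : actExt (gen s) t = s.updExt t := by
  have := actExt_freeProj (FreeGroup.of s)
  rw [freeProj, FreeGroup.lift_apply_of, freeExt, FreeGroup.lift_apply_of] at this
  rw [this]; rfl

theorem gen_mul_self (s : Gen) : gen s * gen s = 1 :=
  Subtype.ext (RelIso.ext fun v => s.act_involutive v)

theorem gen_inv (s : Gen) : (gen s)⁻¹ = gen s := inv_eq_of_mul_eq_one_left (gen_mul_self s)

theorem gen_induction {p : G → Prop} (h1 : p 1) (hg : ∀ s, p (gen s))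
    (hm : ∀ x y, p x → p y → p (x * y)) (x : G) : p x := by
  obtain ⟨x, rfl⟩ := freeProj_surjective x
  induction x using FreeGroup.induction_on with
  | C1 => rwa [map_one]
  | of s => simpa [freeProj] using hg s
  | inv_of s _ => simpa [freeProj, gen_inv] using hg s
  | mul x y hx hy => rw [map_mul]; exact hm _ _ hx hy

theorem subgroup_eq_top {H : Subgroup G} (h : ∀ s, gen s ∈ H) : H = ⊤ :=
  eq_top_iff.2 fun x _ => gen_induction H.one_mem h (fun _ _ => H.mul_mem) x

/-- The preimage of the centre is normal, so it suffices that the five normal generators of `K`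
commute with the four generators on the 64 values. -/
theorem K_le_ker_center :
    K ≤ (Subgroup.center actExt.range).comap actExt.rangeRestrict := by
  have key : ∀ k : G, (∀ (s : Gen) t, actExt k (s.updExt t) = s.updExt (actExt k t)) →
      k ∈ (Subgroup.center actExt.range).comap actExt.rangeRestrict := by
    intro k hk
    rw [Subgroup.mem_comap, Subgroup.mem_center_iff]
    rintro ⟨_, g, rfl⟩
    refine Subtype.ext ?_
    change actExt g * actExt k = actExt k * actExt g
    induction g using gen_induction with
    | h1 => simp
    | hg s => exact Equiv.ext fun t => by simp [actExt_gen, hk]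
    | hm x y hx hy => rw [map_mul, mul_assoc, hy, ← mul_assoc, hx, mul_assoc]
  refine Subgroup.normalClosure_le_normal ?_
  rintro k hk
  refine key k ?_
  simp only [Set.mem_insert_iff, Set.mem_singleton_iff] at hk
  rintro s ⟨⟨i, j, k, l, h⟩, u⟩
  rcases hk with rfl | rfl | rfl | rfl | rfl <;>
  · simp only [commutatorElement_def, a, β, γ, δ, gen_inv, map_mul, Equiv.Perm.mul_apply,
      actExt_gen]
    revert s i j k l h u
    decide

theorem C_le_ker_actExt : C ≤ actExt.ker := by
  refine sup_le (Subgroup.commutator_le.2 fun k hk g _ => ?_) ((Subgroup.closure_le _).2 ?_)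
  · rw [MonoidHom.mem_ker, map_commutatorElement, commutatorElement_eq_one_iff_mul_comm]
    exact (congrArg Subtype.val
      (Subgroup.mem_center_iff.1 (K_le_ker_center hk) (actExt.rangeRestrict g))).symm
  -- Both `[a,β]` and `[β,γ]` act by flipping the phase, so their product acts trivially.
  · rintro _ rfl
    refine MonoidHom.mem_ker.2 (Equiv.ext ?_)
    rintro ⟨⟨i, j, k, l, h⟩, u⟩
    simp only [commutatorElement_def, a, β, γ, gen_inv, map_mul, Equiv.Perm.mul_apply,
      actExt_gen]
    revert i j k l h u
    decide

theorem dvd_index_C : 64 ∣ C.index := by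
  let _ : MulAction G (Invt × Bool) := MulAction.compHom _ actExt
  have h1 : (MulAction.stabilizer G ((Invt.zero, false) : Invt × Bool)).index = 64 := by
    rw [MulAction.index_stabilizer]
    have : MulAction.orbit G ((Invt.zero, false) : Invt × Bool) = Set.univ := by
      refine Set.eq_univ_of_forall fun t => ?_
      obtain ⟨w, rfl⟩ := exists_foldr_updExt t
      induction w with
      | nil => exact MulAction.mem_orbit_self _
      | cons s w ih =>
        obtain ⟨g, hg⟩ := ih
        refine ⟨gen s * g, ?_⟩
        change actExt (gen s * g) _ = _
        rw [map_mul, Equiv.Perm.mul_apply, actExt_gen]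
        exact congrArg s.updExt hg
    rw [this, Set.ncard_univ, Nat.card_eq_fintype_card]
    decide
  rw [← h1]
  refine Subgroup.index_dvd_of_le fun g hg => ?_
  rw [MulAction.mem_stabilizer_iff]
  change actExt g _ = _
  rw [MonoidHom.mem_ker.1 (C_le_ker_actExt hg)]
  rfl

/-! ### Elements as pairs, and self-replication -/

theorem translate_singleton_apply (x : Bool) (g : TreeAut) (u : List Bool) :
    translate [x] g (x :: u) = x :: g u :=
  translateFun_append [x] g u

theorem translate_singleton_nil (x : Bool) (g : TreeAut) : translate [x] g [] = [] :=
  translateFun_of_not [x] g [] (by simp)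

theorem translate_singleton_of_ne {x y : Bool} (h : x ≠ y) (g : TreeAut) (u : List Bool) :
    translate [x] g (y :: u) = y :: u :=
  translateFun_of_not [x] g _ (by simp [h])

theorem translate_append (v w : List Bool) (g : TreeAut) :
    translate (v ++ w) g = translate v (translate w g) := by
  refine RelIso.ext fun u => ?_
  change translateFun (v ++ w) g u = translateFun v (translate w g) u
  by_cases hv : v <+: u
  · obtain ⟨t, rfl⟩ := hv
    rw [translateFun_append]
    change _ = v ++ translateFun w g t
    by_cases hw : w <+: t
    · obtain ⟨s, rfl⟩ := hw
      rw [translateFun_append, ← List.append_assoc, translateFun_append, List.append_assoc]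
    · rw [translateFun_of_not w g t hw, translateFun_of_not _ g _ (by simpa using hw)]
  · rw [translateFun_of_not v _ u hv, translateFun_of_not _ g u
      fun h => hv ((List.prefix_append v w).trans h)]

theorem translate_nil (g : TreeAut) : translate [] g = g :=
  RelIso.ext fun u => translateFun_append [] g u

/-- The automorphism that fixes the vertices of the first level and has the given sections. -/
def pairHom : TreeAut × TreeAut →* TreeAut :=
  MonoidHom.noncommCoprod (translate [false]) (translate [true]) fun g h => by
    refine RelIso.ext fun u => ?_
    rw [RelIso.mul_apply, RelIso.mul_apply]
    match u with
    | [] => simp only [translate_singleton_nil]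
    | false :: u => simp only [translate_singleton_apply, translate_singleton_of_ne, ne_eq,
        reduceCtorEq, not_false_eq_true]
    | true :: u => simp only [translate_singleton_apply, translate_singleton_of_ne, ne_eq,
        reduceCtorEq, not_false_eq_true]

/-- The automorphism that fixes the vertices of the first level and has the given sections. -/
def pair (g h : TreeAut) : TreeAut := pairHom (g, h)

theorem pair_mul (g h g' h' : TreeAut) : pair g h * pair g' h' = pair (g * g') (h * h') :=
  (map_mul pairHom (g, h) (g', h')).symm

theorem pair_mul_assoc (g h g' h' x : TreeAut) :
    pair g h * (pair g' h' * x) = pair (g * g') (h * h') * x := by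
  rw [← mul_assoc, pair_mul]

theorem pair_inv (g h : TreeAut) : (pair g h)⁻¹ = pair g⁻¹ h⁻¹ := (map_inv pairHom (g, h)).symm

theorem pair_one : pair 1 1 = 1 := map_one pairHom

theorem pair_eq (g h : TreeAut) : pair g h = translate [false] g * translate [true] h := rfl

theorem translate_false (g : TreeAut) : translate [false] g = pair g 1 := by
  rw [pair_eq, map_one, mul_one]

theorem translate_true (g : TreeAut) : translate [true] g = pair 1 g := by
  rw [pair_eq, map_one, one_mul]

theorem pair_apply_nil (g h : TreeAut) : pair g h [] = [] := by
  change translate [false] g (translate [true] h []) = []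
  rw [translate_singleton_nil, translate_singleton_nil]

theorem pair_apply_false (g h : TreeAut) (u : List Bool) :
    pair g h (false :: u) = false :: g u := by
  rw [pair_eq, RelIso.mul_apply, translate_singleton_of_ne (by simp), translate_singleton_apply]

theorem pair_apply_true (g h : TreeAut) (u : List Bool) :
    pair g h (true :: u) = true :: h u := by
  rw [pair_eq, RelIso.mul_apply, translate_singleton_apply, translate_singleton_of_ne (by simp)]

theorem pair_injective {g h g' h' : TreeAut} (e : pair g h = pair g' h') : g = g' ∧ h = h' := by
  constructor <;> refine RelIso.ext fun u => ?_
  · have := congrArg (fun f : TreeAut => f (false :: u)) e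
    simpa only [pair_apply_false, List.cons.injEq, true_and] using this
  · have := congrArg (fun f : TreeAut => f (true :: u)) e
    simpa only [pair_apply_true, List.cons.injEq, true_and] using this

theorem eq_pair_of_forall {f g h : TreeAut} (h0 : f [] = [])
    (h1 : ∀ u, f (false :: u) = false :: g u) (h2 : ∀ u, f (true :: u) = true :: h u) :
    f = pair g h := by
  refine RelIso.ext fun u => ?_
  match u with
  | [] => rw [h0, pair_apply_nil]
  | false :: u => rw [h1, pair_apply_false]
  | true :: u => rw [h2, pair_apply_true]

theorem toAut_a_mul_self : Gen.a.toAut * Gen.a.toAut = 1 := congrArg Subtype.val (gen_mul_self .a)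

theorem toAut_a_mul_self_assoc (x : TreeAut) : Gen.a.toAut * (Gen.a.toAut * x) = x := by
  rw [← mul_assoc, toAut_a_mul_self, one_mul]

theorem toAut_inv (s : Gen) : (s.toAut)⁻¹ = s.toAut := congrArg Subtype.val (gen_inv s)

theorem toAut_a_mul_pair (g h : TreeAut) :
    Gen.a.toAut * pair g h = pair h g * Gen.a.toAut := by
  refine RelIso.ext fun u => ?_
  rw [RelIso.mul_apply, RelIso.mul_apply]
  match u with
  | [] => change Gen.a.act (pair g h []) = pair h g []
          rw [pair_apply_nil, pair_apply_nil]; rfl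
  | false :: u => change Gen.a.act (pair g h _) = pair h g (true :: u)
                  rw [pair_apply_false, pair_apply_true]; rfl
  | true :: u => change Gen.a.act (pair g h _) = pair h g (false :: u)
                 rw [pair_apply_false, pair_apply_true]; rfl

theorem toAut_a_mul_pair_assoc (g h x : TreeAut) :
    Gen.a.toAut * (pair g h * x) = pair h g * (Gen.a.toAut * x) := by
  rw [← mul_assoc, toAut_a_mul_pair, mul_assoc]

theorem toAut_β : Gen.β.toAut = pair Gen.γ.toAut Gen.a.toAut :=
  eq_pair_of_forall rfl (fun _ => rfl) fun _ => rfl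

theorem toAut_γ : Gen.γ.toAut = pair Gen.a.toAut Gen.δ.toAut :=
  eq_pair_of_forall rfl (fun _ => rfl) fun _ => rfl

theorem toAut_δ : Gen.δ.toAut = pair 1 Gen.β.toAut :=
  eq_pair_of_forall rfl (fun _ => rfl) fun _ => rfl

/-- The coercion of `gen s` is `s.toAut`. -/
theorem coe_gen (s : Gen) : (gen s : TreeAut) = s.toAut := rfl

theorem exists_pair (g : G) : ∃ g₀ g₁ : G,
    (g : TreeAut) = pair g₀ g₁ ∨ (g : TreeAut) = pair g₀ g₁ * Gen.a.toAut := by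
  induction g using gen_induction with
  | h1 => exact ⟨1, 1, .inl pair_one.symm⟩
  | hg s =>
    cases s with
    | a => exact ⟨1, 1, .inr (by rw [G.coe_one, pair_one, one_mul]; rfl)⟩
    | β => exact ⟨γ, a, .inl toAut_β⟩
    | γ => exact ⟨a, δ, .inl toAut_γ⟩
    | δ => exact ⟨1, β, .inl toAut_δ⟩
  | hm x y hx hy =>
    obtain ⟨x₀, x₁, hx⟩ := hx
    obtain ⟨y₀, y₁, hy⟩ := hy
    rcases hx with hx | hx <;> rcases hy with hy | hy
    · exact ⟨x₀ * y₀, x₁ * y₁, .inl (by simp only [G.coe_mul, hx, hy, pair_mul])⟩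
    · exact ⟨x₀ * y₀, x₁ * y₁, .inr (by
        simp only [G.coe_mul, hx, hy, pair_mul_assoc])⟩
    · exact ⟨x₀ * y₁, x₁ * y₀, .inr (by
        simp only [G.coe_mul, hx, hy, pair_mul_assoc, mul_assoc, toAut_a_mul_pair])⟩
    · exact ⟨x₀ * y₁, x₁ * y₀, .inl (by
        simp only [G.coe_mul, hx, hy, pair_mul, mul_assoc, toAut_a_mul_pair_assoc,
          toAut_a_mul_self, mul_one])⟩

/-- `G` is self-replicating. -/
theorem exists_lift (g : G) : ∃ h k : G, (h : TreeAut) = pair g k := by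
  induction g using gen_induction with
  | h1 => exact ⟨1, 1, pair_one.symm⟩
  | hg s =>
    cases s with
    | a => exact ⟨γ, δ, toAut_γ⟩
    | β =>
      refine ⟨a * δ * a, 1, ?_⟩
      simp only [G.coe_mul, a, δ, coe_gen, toAut_δ, mul_assoc, toAut_a_mul_pair_assoc,
        toAut_a_mul_self, mul_one, G.coe_one]
    | γ => exact ⟨β, a, toAut_β⟩
    | δ =>
      refine ⟨a * γ * a, a, ?_⟩
      simp only [G.coe_mul, a, γ, coe_gen, toAut_γ, mul_assoc, toAut_a_mul_pair_assoc,
        toAut_a_mul_self, mul_one]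
  | hm x y hx hy =>
    obtain ⟨x', x₁, hx⟩ := hx
    obtain ⟨y', y₁, hy⟩ := hy
    exact ⟨x' * y', x₁ * y₁, by simp only [G.coe_mul, hx, hy, pair_mul]⟩

/-! ### Copies of subgroups one level down -/

/-- The elements `x` of `G` such that `0 * x` is in `D`. -/
def below (D : Subgroup G) : Subgroup G :=
  (D.map G.subtype).comap ((translate [false]).comp G.subtype)

theorem mem_below {D : Subgroup G} {x : G} :
    x ∈ below D ↔ ∃ y ∈ D, (y : TreeAut) = pair x 1 := by
  rw [← translate_false]; rfl

theorem below_mono {D D' : Subgroup G} (h : D ≤ D') : below D ≤ below D' :=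
  Subgroup.comap_mono (Subgroup.map_mono h)

/-- Self-replication lifts `g` to some `(g, k)`; conjugating `(x, 1)` by it leaves the second
coordinate trivial whatever `k` is. -/
instance below_normal (D : Subgroup G) [hD : D.Normal] : (below D).Normal where
  conj_mem x hx g := by
    obtain ⟨y, hy, e⟩ := mem_below.1 hx
    obtain ⟨h, k, e'⟩ := exists_lift g
    refine mem_below.2 ⟨h * y * h⁻¹, hD.conj_mem y hy h, ?_⟩
    simp only [G.coe_mul, G.coe_inv, e, e', pair_mul, pair_inv, mul_one, mul_inv_cancel]

theorem mem_below' {D : Subgroup G} [hD : D.Normal] {x : G} :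
    x ∈ below D ↔ ∃ y ∈ D, (y : TreeAut) = pair 1 x := by
  have key : ∀ y : G, (y : TreeAut) = pair x 1 ↔ ((a * y * a⁻¹ : G) : TreeAut) = pair 1 x := by
    intro y
    have : ((a * y * a⁻¹ : G) : TreeAut) = Gen.a.toAut * y * Gen.a.toAut := by
      simp only [a, gen_inv]; rfl
    rw [this]
    constructor
    · intro h
      simp only [h, mul_assoc, toAut_a_mul_pair_assoc, toAut_a_mul_self, mul_one]
    · intro h
      have := congrArg (fun t => Gen.a.toAut * t * Gen.a.toAut) h
      simpa only [mul_assoc, toAut_a_mul_pair_assoc, toAut_a_mul_self, mul_one,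
        toAut_a_mul_self_assoc] using this
  rw [mem_below]
  constructor
  · rintro ⟨y, hy, e⟩
    exact ⟨_, hD.conj_mem y hy a, (key y).1 e⟩
  · rintro ⟨y, hy, e⟩
    refine ⟨a⁻¹ * y * a⁻¹⁻¹, hD.conj_mem y hy _, (key _).2 ?_⟩
    rw [← e]; congr 1; group

theorem mem_map_subtype_translate {D : Subgroup G} [D.Normal] (b : Bool) {x : G} :
    translate [b] x ∈ D.map G.subtype ↔ x ∈ below D := by
  cases b
  · rfl
  · rw [mem_below', translate_true]; rfl

instance K_normal : K.Normal := Subgroup.normalClosure_normal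

theorem a_mul_a : a * a = 1 := gen_mul_self .a
theorem β_mul_β : β * β = 1 := gen_mul_self .β
theorem γ_mul_γ : γ * γ = 1 := gen_mul_self .γ
theorem δ_mul_δ : δ * δ = 1 := gen_mul_self .δ
theorem a_inv : a⁻¹ = a := gen_inv .a
theorem β_inv : β⁻¹ = β := gen_inv .β
theorem γ_inv : γ⁻¹ = γ := gen_inv .γ
theorem δ_inv : δ⁻¹ = δ := gen_inv .δ
theorem coe_a : (a : TreeAut) = Gen.a.toAut := rfl
theorem coe_β : (β : TreeAut) = pair γ a := toAut_β
theorem coe_γ : (γ : TreeAut) = pair a δ := toAut_γ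
theorem coe_δ : (δ : TreeAut) = pair 1 β := toAut_δ

theorem coe_conj_a {x : G} {g h : TreeAut} (e : (x : TreeAut) = pair g h) :
    ((a * x * a : G) : TreeAut) = pair h g := by
  simp only [G.coe_mul, e, coe_a, mul_assoc, toAut_a_mul_pair_assoc, toAut_a_mul_self, mul_one]

theorem coe_conj_a_δ : ((a * δ * a : G) : TreeAut) = pair β 1 := coe_conj_a coe_δ

theorem coe_mul_eq_pair {x y : G} {g h g' h' : TreeAut} (ex : (x : TreeAut) = pair g h)
    (ey : (y : TreeAut) = pair g' h') : ((x * y : G) : TreeAut) = pair (g * g') (h * h') := by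
  rw [G.coe_mul, ex, ey, pair_mul]

theorem coe_commutator_eq_pair {x y : G} {g h g' h' : TreeAut} (ex : (x : TreeAut) = pair g h)
    (ey : (y : TreeAut) = pair g' h') : ((⁅x, y⁆ : G) : TreeAut) = pair ⁅g, g'⁆ ⁅h, h'⁆ := by
  change ⁅(x : TreeAut), (y : TreeAut)⁆ = _
  rw [ex, ey]
  simp only [commutatorElement_def, pair_mul, pair_inv]

theorem commute_δ_conj : δ * (a * δ * a) = a * δ * a * δ :=
  Subtype.ext (by rw [coe_mul_eq_pair coe_δ coe_conj_a_δ, coe_mul_eq_pair coe_conj_a_δ coe_δ,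
    mul_one, one_mul])

/-- The factors have coordinates `β, γ, δ` at `0` and `1, a, a` at `1`, and the latter cancel. -/
theorem coe_lift_βγδ : ((a * δ * a * β * (a * γ * a) : G) : TreeAut) =
    pair ((β * γ * δ : G) : TreeAut) 1 := by
  rw [coe_mul_eq_pair (coe_mul_eq_pair coe_conj_a_δ coe_β) (coe_conj_a coe_γ), one_mul]
  congr 1
  exact congrArg Subtype.val a_mul_a

theorem coe_lift_aβ : ((⁅γ, a * δ * a⁆ : G) : TreeAut) = pair ((⁅a, β⁆ : G) : TreeAut) 1 := by
  rw [coe_commutator_eq_pair coe_γ coe_conj_a_δ, commutatorElement_one_right]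
  rfl

theorem coe_lift_βγ : ((⁅a * δ * a, β⁆ : G) : TreeAut) = pair ((⁅β, γ⁆ : G) : TreeAut) 1 := by
  rw [coe_commutator_eq_pair coe_conj_a_δ coe_β, commutatorElement_one_left]
  rfl

theorem coe_lift_βδ :
    ((⁅a * δ * a, a * γ * a⁆ : G) : TreeAut) = pair ((⁅β, δ⁆ : G) : TreeAut) 1 := by
  rw [coe_commutator_eq_pair coe_conj_a_δ (coe_conj_a coe_γ), commutatorElement_one_left]
  rfl

section Relations

variable {Q : Type*} [Group Q] {a b c d : Q}

/-- This eliminates `c` in favour of `b`, `d` and `z = bcd`. Abstract groups are used so that the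
computations apply in several quotients of `G`. -/
theorem eq_mul_of_central (hb : b * b = 1) (hd : d * d = 1) (hz : Commute (b * c * d) d) :
    c = b * d * (b * c * d) := by
  have h1 : d * (b * c * d) = b * c := by
    rw [hz.eq.symm, mul_assoc, hd, mul_one]
  rw [mul_assoc, h1, ← mul_assoc, hb, one_mul]

/-- In the situation where `bcd` is central and `d` commutes with its conjugate by `a`, the
commutators of that conjugate with `b` and `c` agree. -/
theorem commutator_eq_of_central (hb : b * b = 1) (hd : d * d = 1)
    (hz : ∀ x, Commute (b * c * d) x) (had : d * (a * d * a) = a * d * a * d) :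
    ⁅c, a * d * a⁆ = ⁅b, a * d * a⁆ := by
  rw [eq_mul_of_central hb hd (hz d)]
  generalize b * c * d = z at *
  generalize a * d * a = e at *
  simp only [commutatorElement_def, mul_inv_rev]
  have h1 : z * e = e * z := (hz e).eq
  calc b * d * z * e * (z⁻¹ * (d⁻¹ * b⁻¹)) * e⁻¹ = b * d * (z * e) * z⁻¹ * d⁻¹ * b⁻¹ * e⁻¹ := by
        group
    _ = b * (d * e) * d⁻¹ * b⁻¹ * e⁻¹ := by rw [h1]; group
    _ = b * e * b⁻¹ * e⁻¹ := by rw [had]; group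

theorem lift_eq_one (ha : a * a = 1) (hb : b * b = 1) (hd : d * d = 1)
    (hab : a * b = b * a) (hz : b * c * d = 1) : a * d * a * b * (a * c * a) = 1 := by
  have hc : c = b * d := by
    have := eq_mul_of_central (c := c) hb hd (by rw [hz]; exact Commute.one_left d)
    rwa [hz, mul_one] at this
  have h1 : a * b * a * b = 1 := by rw [hab, mul_assoc b, ha, mul_one, hb]
  calc a * d * a * b * (a * c * a) = a * d * (a * b * a * b) * d * a := by
        rw [hc]; simp only [mul_assoc]
    _ = 1 := by rw [h1, mul_one, mul_assoc a, hd, mul_one, ha]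

end Relations

theorem mem_K_of {x : G} (hx : x ∈ ({⁅a, β⁆, ⁅β, γ⁆, ⁅β, δ⁆, ⁅γ, δ⁆, β * γ * δ} : Set G)) : x ∈ K :=
  Subgroup.subset_normalClosure hx

theorem commutator_aβ_mem_K : ⁅a, β⁆ ∈ K := mem_K_of (by simp)
theorem commutator_βγ_mem_K : ⁅β, γ⁆ ∈ K := mem_K_of (by simp)
theorem commutator_βδ_mem_K : ⁅β, δ⁆ ∈ K := mem_K_of (by simp)
theorem βγδ_mem_K : β * γ * δ ∈ K := mem_K_of (by simp)

theorem mk_commute_of_mem {N : Subgroup G} [N.Normal] {x y : G} (h : ⁅x, y⁆ ∈ N) :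
    (x : G ⧸ N) * y = y * x := by
  have := (QuotientGroup.eq_one_iff _).2 h
  rwa [← QuotientGroup.mk'_apply, map_commutatorElement,
    commutatorElement_eq_one_iff_mul_comm] at this

theorem lift_βγδ_mem_K : a * δ * a * β * (a * γ * a) ∈ K := by
  rw [← QuotientGroup.eq_one_iff]
  exact lift_eq_one (a := (a : G ⧸ K)) (b := β) (c := γ) (d := δ) (congrArg _ a_mul_a) (congrArg _ β_mul_β) (congrArg _ δ_mul_δ)
    (mk_commute_of_mem commutator_aβ_mem_K) ((QuotientGroup.eq_one_iff _).2 βγδ_mem_K)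

theorem mk_commutator_conj {N : Subgroup G} [N.Normal]
    (hN : ∀ x : G ⧸ N, Commute ((β * γ * δ : G) : G ⧸ N) x) :
    ((⁅γ, a * δ * a⁆ : G) : G ⧸ N) = ((⁅β, a * δ * a⁆ : G) : G ⧸ N) :=
  commutator_eq_of_central (a := (a : G ⧸ N)) (b := β) (c := γ) (d := δ) (congrArg _ β_mul_β) (congrArg _ δ_mul_δ) hN
    (congrArg _ commute_δ_conj)

theorem mk_commute_βδ_conj : ((⁅β, a * δ * a⁆ : G) : G ⧸ K) = 1 := by
  have h1 := mk_commute_of_mem commutator_aβ_mem_K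
  have h2 := mk_commute_of_mem commutator_βδ_mem_K
  have : Commute (β : G ⧸ K) ((a * δ * a : G) : G ⧸ K) :=
    ((Commute.mul_right h1.symm h2).mul_right h1.symm)
  exact commutatorElement_eq_one_iff_commute.2 this

/-- As `below K` is normal, it is enough to find for each normal generator `x` of `K` an element
`(x, 1)` in `K`. -/
theorem K_le_below_K : K ≤ below K := by
  have h5 : β * γ * δ ∈ below K := mem_below.2 ⟨_, lift_βγδ_mem_K, coe_lift_βγδ⟩
  have h1 : (⁅β, a * δ * a⁆ : G) ∈ K := (QuotientGroup.eq_one_iff _).1 mk_commute_βδ_conj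
  have hab : ⁅a, β⁆ ∈ below K := by
    refine mem_below.2 ⟨⁅γ, a * δ * a⁆, ?_, coe_lift_aβ⟩
    rw [← QuotientGroup.eq_one_iff, mk_commutator_conj, mk_commute_βδ_conj]
    intro x
    rw [(QuotientGroup.eq_one_iff _).2 βγδ_mem_K]
    exact Commute.one_left x
  have hbc : ⁅β, γ⁆ ∈ below K := by
    refine mem_below.2 ⟨⁅a * δ * a, β⁆, ?_, coe_lift_βγ⟩
    rw [← commutatorElement_inv]
    exact K.inv_mem h1
  have hcd : ⁅γ, δ⁆ ∈ below K := by
    -- With `β² = 1`, the product `β (βγδ) β (βγδ)` collapses to `γδγδ`.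
    have : ⁅γ, δ⁆ = β * (β * γ * δ) * β⁻¹ * (β * γ * δ) := by
      rw [commutatorElement_def, γ_inv, δ_inv, β_inv]
      calc γ * δ * γ * δ = β * β * γ * δ * (β * β) * γ * δ := by rw [β_mul_β]; simp
        _ = _ := by simp only [mul_assoc]
    rw [this]
    exact mul_mem ((below_normal K).conj_mem _ h5 _) h5
  have hbd : ⁅β, δ⁆ ∈ below K := by
    refine mem_below.2 ⟨⁅a * δ * a, a * γ * a⁆, ?_, coe_lift_βδ⟩
    have : ⁅a * δ * a, a * γ * a⁆ = a * ⁅γ, δ⁆⁻¹ * a⁻¹ := by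
      have h : ∀ x, a * x * a = a * x * a⁻¹ := fun x => by rw [a_inv]
      rw [h, h, commutatorElement_inv, conjugate_commutatorElement]
    rw [this]
    exact K_normal.conj_mem _ (K.inv_mem (mem_K_of (by simp))) _
  refine Subgroup.normalClosure_le_normal ?_
  rintro x (rfl | rfl | rfl | rfl | rfl) <;> assumption

/-- The subgroup `[K, G]`. -/
def KG : Subgroup G := ⁅K, (⊤ : Subgroup G)⁆

instance KG_normal : KG.Normal := Subgroup.commutator_normal _ _

theorem KG_le_K : KG ≤ K := Subgroup.commutator_le_left _ _

theorem KG_le_C : KG ≤ C := le_sup_left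

theorem C_le {H : Subgroup G} (h : KG ≤ H) (h' : ⁅a, β⁆ * ⁅β, γ⁆ ∈ H) : C ≤ H :=
  sup_le h ((Subgroup.closure_le _).2 (by rintro _ rfl; exact h'))

theorem C_le_K : C ≤ K :=
  C_le KG_le_K (K.mul_mem commutator_aβ_mem_K commutator_βγ_mem_K)

theorem commutator_mem_KG {k : G} (hk : k ∈ K) (g : G) : ⁅k, g⁆ ∈ KG :=
  Subgroup.commutator_mem_commutator hk (Subgroup.mem_top g)

instance C_normal : C.Normal where
  conj_mem x hx g := by
    have h : g * x * g⁻¹ = ⁅x, g⁆⁻¹ * x := by rw [commutatorElement_inv, commutatorElement_def]; group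
    rw [h]
    exact C.mul_mem (C.inv_mem (KG_le_C (commutator_mem_KG (C_le_K hx) g))) hx

/-- The image of `K` is central in every quotient by a normal subgroup that contains `[K, G]`. -/
theorem mk_commute_of_mem_K {N : Subgroup G} [N.Normal] (hN : KG ≤ N) {k : G} (hk : k ∈ K)
    (x : G ⧸ N) : Commute (k : G ⧸ N) x := by
  induction x using QuotientGroup.induction_on with
  | H x => exact mk_commute_of_mem (hN (commutator_mem_KG hk x))

theorem KG_le_below_KG : KG ≤ below KG := by
  refine Subgroup.commutator_le.2 fun k hk g _ => ?_
  obtain ⟨y, hy, e⟩ := mem_below.1 (K_le_below_K hk)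
  obtain ⟨h, k', e'⟩ := exists_lift g
  refine mem_below.2 ⟨⁅y, h⁆, commutator_mem_KG hy h, ?_⟩
  rw [coe_commutator_eq_pair e e', commutatorElement_one_left]
  rfl

/-- The generator `[a,β][β,γ]` in the definition of `C` is chosen for this gain from `C` to `[K,G]`.
-/
theorem C_le_below_KG : C ≤ below KG := by
  refine C_le KG_le_below_KG (mem_below.2 ⟨⁅γ, a * δ * a⁆ * ⁅a * δ * a, β⁆, ?_, ?_⟩)
  · rw [← QuotientGroup.eq_one_iff, QuotientGroup.mk_mul,
      mk_commutator_conj (mk_commute_of_mem_K le_rfl βγδ_mem_K), ← QuotientGroup.mk_mul,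
      ← commutatorElement_inv β, mul_inv_cancel, QuotientGroup.mk_one]
  · rw [coe_mul_eq_pair coe_lift_aβ coe_lift_βγ, mul_one]
    rfl

/-! ### From `[K,G]` down to `[K,K]` -/

/-- The elements whose commutators with the elements of `K` are in `F`. -/
def relCentralizer (F : Subgroup G) [F.Normal] : Subgroup G :=
  (Subgroup.centralizer (K.map (QuotientGroup.mk' F) : Set (G ⧸ F))).comap (QuotientGroup.mk' F)

theorem mem_relCentralizer {F : Subgroup G} [F.Normal] {p : G} :
    p ∈ relCentralizer F ↔ ∀ k ∈ K, ⁅k, p⁆ ∈ F := by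
  rw [relCentralizer, Subgroup.mem_comap, Subgroup.mem_centralizer_iff]
  simp only [SetLike.mem_coe, Subgroup.mem_map, forall_exists_index, and_imp,
    forall_apply_eq_imp_iff₂, ← commutatorElement_eq_one_iff_mul_comm]
  refine forall₂_congr fun k _ => ?_
  rw [← map_commutatorElement]
  exact QuotientGroup.eq_one_iff _

/-- For `k` in `K` the element `(k, 1)` lies in `K`, and its commutator with `(p, q)` is `([k,p],
1)`. -/
theorem relCentralizer_of_pair {F : Subgroup G} [F.Normal] {s p q : G}
    (hs : s ∈ relCentralizer F) (e : (s : TreeAut) = pair p q) : p ∈ relCentralizer (below F) := by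
  refine mem_relCentralizer.2 fun k hk => ?_
  obtain ⟨y, hy, e'⟩ := mem_below.1 (K_le_below_K hk)
  refine mem_below.2 ⟨⁅y, s⁆, mem_relCentralizer.1 hs y hy, ?_⟩
  rw [coe_commutator_eq_pair e' e, commutatorElement_one_left]
  rfl

theorem coe_βγδ : ((β * γ * δ : G) : TreeAut) =
    pair ((γ * a : G) : TreeAut) ((a * δ * β : G) : TreeAut) := by
  rw [coe_mul_eq_pair (coe_mul_eq_pair coe_β coe_γ) coe_δ, mul_one]; rfl

theorem coe_γδβ : ((γ * δ * β : G) : TreeAut) =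
    pair ((a * γ : G) : TreeAut) ((δ * β * a : G) : TreeAut) := by
  rw [coe_mul_eq_pair (coe_mul_eq_pair coe_γ coe_δ) coe_β, mul_one]; rfl

theorem γδβ_mem_K : γ * δ * β ∈ K := by
  have := K_normal.conj_mem _ βγδ_mem_K β
  rw [β_inv] at this
  simpa only [← mul_assoc, β_mul_β, one_mul] using this

/-- Each relative centralizer contains the first coordinates of the elements of the previous one
that fix the first level. Beginning with `βγδ`, `γδβ` and their conjugates by `a`, three projections
produce all four generators. -/
theorem relCentralizer_third_eq_top {F : Subgroup G} [F.Normal] (h : K ≤ relCentralizer F) :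
    relCentralizer (below (below (below F))) = ⊤ := by
  have conj_mem : ∀ {x}, x ∈ K → a * x * a ∈ K := by
    intro x hx
    have := K_normal.conj_mem x hx a
    rwa [a_inv] at this
  have u1 : γ * a ∈ relCentralizer (below F) := relCentralizer_of_pair (h βγδ_mem_K) coe_βγδ
  have u2 : a * γ ∈ relCentralizer (below F) := relCentralizer_of_pair (h γδβ_mem_K) coe_γδβ
  have u3 : a * δ * β ∈ relCentralizer (below F) :=
    relCentralizer_of_pair (h (conj_mem βγδ_mem_K)) (coe_conj_a coe_βγδ)
  have u4 : δ * β * a ∈ relCentralizer (below F) :=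
    relCentralizer_of_pair (h (conj_mem γδβ_mem_K)) (coe_conj_a coe_γδβ)
  have v1 : a * δ ∈ relCentralizer (below (below F)) := by
    have e : ((γ * a * (γ * a) : G) : TreeAut) = pair ((a * δ : G) : TreeAut) (δ * a : G) := by
      rw [← mul_assoc, mul_assoc γ, mul_assoc γ, coe_mul_eq_pair coe_γ (coe_conj_a coe_γ)]; rfl
    exact relCentralizer_of_pair (mul_mem u1 u1) e
  have v2 : a * γ ∈ relCentralizer (below (below F)) := by
    have e : γ * a * (a * δ * β) = γ * δ * β := by
      rw [mul_assoc a, ← mul_assoc (γ * a), mul_assoc γ, a_mul_a, mul_one, ← mul_assoc]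
    have := mul_mem u1 u3
    rw [e] at this
    exact relCentralizer_of_pair this coe_γδβ
  have v3 : δ * β * a ∈ relCentralizer (below (below F)) := by
    have e : a * γ * (δ * β * a) = a * (γ * δ * β) * a := by simp only [mul_assoc]
    have := mul_mem u2 u4
    rw [e] at this
    exact relCentralizer_of_pair this (coe_conj_a coe_γδβ)
  have v4 : a * β * a ∈ relCentralizer (below (below F)) := by
    have e : a * δ * (δ * β * a) = a * β * a := by
      rw [mul_assoc δ, ← mul_assoc (a * δ), mul_assoc a, δ_mul_δ, mul_one, mul_assoc]
    exact e ▸ mul_mem v1 v3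
  have w1 : a ∈ relCentralizer (below (below (below F))) :=
    relCentralizer_of_pair v4 (coe_conj_a coe_β)
  have w2 : β ∈ relCentralizer (below (below (below F))) := by
    have e : ((a * δ * (a * δ) : G) : TreeAut) = pair β β := by
      rw [← mul_assoc, coe_mul_eq_pair coe_conj_a_δ coe_δ, mul_one, one_mul]
    exact relCentralizer_of_pair (mul_mem v1 v1) e
  have w3 : δ ∈ relCentralizer (below (below (below F))) := by
    have e : ((a * γ * (a * δ)⁻¹ : G) : TreeAut) = pair (δ * β : G) a := by
      have : a * γ * (a * δ)⁻¹ = a * (γ * δ) * a := by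
        rw [mul_inv_rev, a_inv, δ_inv]; simp only [mul_assoc]
      rw [this, coe_conj_a (coe_mul_eq_pair coe_γ coe_δ), mul_one]
      rfl
    have := mul_mem (relCentralizer_of_pair (mul_mem v2 (inv_mem v1)) e) w2
    rwa [mul_assoc, β_mul_β, mul_one] at this
  have w4 : γ ∈ relCentralizer (below (below (below F))) := by
    have e : ((a * δ * (a * β * a) * (a * δ)⁻¹ : G) : TreeAut) = pair (β * γ * β : G) a := by
      have : a * δ * (a * β * a) * (a * δ)⁻¹ = a * δ * a * β * (a * δ * a) := by
        rw [mul_inv_rev, a_inv, δ_inv]; simp only [mul_assoc]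
      rw [this, coe_mul_eq_pair (coe_mul_eq_pair coe_conj_a_δ coe_β) coe_conj_a_δ, mul_one, one_mul]
      rfl
    have := relCentralizer_of_pair (mul_mem (mul_mem v1 v4) (inv_mem v1)) e
    have := mul_mem (mul_mem w2 this) w2
    rwa [mul_assoc, mul_assoc (β * γ), β_mul_β, mul_one, ← mul_assoc, β_mul_β, one_mul] at this
  refine subgroup_eq_top fun s => ?_
  cases s <;> assumption

theorem C_le_below_commutator_K : C ≤ below (below (below (below ⁅K, K⁆))) := by
  refine C_le_below_KG.trans (below_mono (Subgroup.commutator_le.2 fun k hk g _ => ?_))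
  have h : K ≤ relCentralizer ⁅K, K⁆ := fun p hp =>
    mem_relCentralizer.2 fun k hk => Subgroup.commutator_mem_commutator hk hp
  have := relCentralizer_third_eq_top h
  exact mem_relCentralizer.1 (this ▸ Subgroup.mem_top g) k hk

/-! ### The upper bound for the index of `C` -/

/-- Adjoining to a subgroup an element that normalizes it and whose square is in it at most
doubles the order. -/
theorem card_closure_insert_le {Q : Type*} [Group Q] {S : Set Q} {x : Q} {n : ℕ}
    (hS : (Subgroup.closure S : Set Q).encard ≤ n) (hx : x * x ∈ Subgroup.closure S)
    (hc : ∀ s ∈ S, x * s * x⁻¹ ∈ Subgroup.closure S) :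
    (Subgroup.closure (insert x S) : Set Q).encard ≤ (2 * n : ℕ) := by
  set H := Subgroup.closure S with hH
  have hn : ∀ h ∈ H, x * h * x⁻¹ ∈ H := by
    have : H ≤ H.comap (MulAut.conj x).toMonoidHom := (Subgroup.closure_le _).2 hc
    exact this
  have hxi : x⁻¹ * x⁻¹ ∈ H := by simpa using H.inv_mem hx
  have hn' : ∀ h ∈ H, x⁻¹ * h * x ∈ H := by
    intro h hh
    have := H.mul_mem (H.mul_mem hxi (hn h hh)) hx
    convert this using 1
    group
  let H' : Subgroup Q :=
    { carrier := H ∪ (fun h => x * h) '' H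
      one_mem' := .inl H.one_mem
      mul_mem' := by
        rintro _ _ (h₁ | ⟨h₁, m₁, rfl⟩) (h₂ | ⟨h₂, m₂, rfl⟩)
        · exact .inl (H.mul_mem h₁ h₂)
        · rename_i u
          exact .inr ⟨x⁻¹ * u * x * h₂, H.mul_mem (hn' u h₁) m₂, by dsimp only; group⟩
        · exact .inr ⟨_, H.mul_mem m₁ h₂, by dsimp only; group⟩
        · have := H.mul_mem (H.mul_mem (hn h₁ m₁) hx) m₂
          have e : x * h₁ * x⁻¹ * (x * x) * h₂ = x * h₁ * (x * h₂) := by group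
          exact .inl (e ▸ this)
      inv_mem' := by
        rintro _ (h | ⟨h, m, rfl⟩)
        · exact .inl (H.inv_mem h)
        · refine .inr ⟨_, H.mul_mem hxi (hn _ (H.inv_mem m)), ?_⟩
          dsimp only; group }
  have hle : Subgroup.closure (insert x S) ≤ H' := by
    refine (Subgroup.closure_le _).2 (Set.insert_subset ?_ fun s hs => ?_)
    · exact .inr ⟨1, H.one_mem, mul_one x⟩
    · exact .inl (Subgroup.subset_closure hs)
  calc (Subgroup.closure (insert x S) : Set Q).encard ≤ (H' : Set Q).encard :=
        Set.encard_le_encard hle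
    _ ≤ (H : Set Q).encard + ((fun h => x * h) '' (H : Set Q)).encard := Set.encard_union_le _ _
    _ ≤ n + n := add_le_add hS ((Set.encard_image_le _ _).trans hS)
    _ = (2 * n : ℕ) := by push_cast; ring

theorem encard_closure_singleton_le {Q : Type*} [Group Q] {z : Q} {n : ℕ} (hn : 0 < n)
    (h : z ^ n = 1) : (Subgroup.closure {z} : Set Q).encard ≤ n := by
  rw [← Subgroup.zpowers_eq_closure]
  have : (Subgroup.zpowers z : Set Q) ⊆ (fun i => z ^ i) '' (Finset.range n : Set ℕ) := by
    rintro _ ⟨i, rfl⟩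
    refine ⟨(i % n).toNat, ?_, ?_⟩
    · have := Int.emod_lt_of_pos i (Int.natCast_pos.2 hn)
      have := Int.emod_nonneg i (Int.natCast_pos.2 hn).ne'
      simp only [Finset.coe_range, Set.mem_Iio]
      omega
    · dsimp only
      rw [← zpow_natCast, Int.toNat_of_nonneg (Int.emod_nonneg i (Int.natCast_pos.2 hn).ne')]
      conv_rhs => rw [← Int.emod_add_mul_ediv i n, zpow_add, zpow_mul, zpow_natCast, h, one_zpow,
        mul_one]
  calc _ ≤ _ := Set.encard_le_encard this
    _ ≤ _ := Set.encard_image_le _ _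
    _ = n := by rw [Set.encard_coe_eq_coe_finsetCard, Finset.card_range]

section Relations

variable {Q : Type*} [Group Q] {a b c d : Q}

/-- The chain of subgroups starts with the cyclic group of `z` and adjoins `b`, `d`, `ada`, `a`.
Each new element is an involution and conjugates the earlier generators into the group they
generate, as `e1`, `e2`, `e3` show. -/
theorem encard_closure_le_of_central (ha : a * a = 1) (hb : b * b = 1) (hc : c * c = 1)
    (hd : d * d = 1) (hz : ∀ x, Commute (b * c * d) x) (hbc : ⁅a, b⁆ * ⁅b, c⁆ = 1)
    (had : d * (a * d * a) = a * d * a * d) :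
    (Subgroup.closure {a, a * d * a, d, b, b * c * d} : Set Q).encard ≤ (64 : ℕ) := by
  have inv_of : ∀ {x : Q}, x * x = 1 → x⁻¹ = x := fun h => inv_eq_of_mul_eq_one_left h
  have hc' := eq_mul_of_central hb hd (hz d)
  generalize b * c * d = z at *
  have ai := inv_of ha
  have bi := inv_of hb
  have di := inv_of hd
  have z2 : (b * d * (b * d)) * z ^ 2 = 1 := by
    have : (b * d * z) * (b * d * z) = 1 := hc' ▸ hc
    calc (b * d * (b * d)) * z ^ 2 = b * d * (b * d * z) * z := by rw [pow_two]; group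
      _ = b * d * (z * (b * d)) * z := by rw [(hz (b * d)).eq]
      _ = 1 := by rw [← this]; group
  have e1 : d * b * d = z ^ 2 * b := by
    have : z ^ 2 = d * b * d * b := by
      rw [← inv_eq_of_mul_eq_one_right z2]
      simp only [mul_inv_rev, bi, di, mul_assoc]
    rw [this, mul_assoc _ b b, hb, mul_one]
  have zc : ∀ x, z ^ 2 * x = x * z ^ 2 := fun x => ((hz x).pow_left 2).eq
  -- `z ^ 2` equals both `dbdb` and `bdbd`, which are inverse to each other.
  have z4 : z ^ 4 = 1 := by
    have h1 : z ^ 2 = d * b * d * b := by rw [e1, mul_assoc, hb, mul_one]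
    have h2 : z ^ 2 = b * d * b * d := by
      rw [mul_assoc b, mul_assoc b, e1, ← mul_assoc, ← zc, mul_assoc, hb, mul_one]
    calc z ^ 4 = z ^ 2 * z ^ 2 := by rw [← pow_add]
      _ = (d * b * d * b) * (b * d * b * d) := by rw [← h1, ← h2]
      _ = d * b * d * (b * b) * d * b * d := by simp only [mul_assoc]
      _ = d * b * (d * d) * b * d := by rw [hb, mul_one, mul_assoc (d * b)]
      _ = 1 := by rw [hd, mul_one, mul_assoc d, hb, mul_one, hd]
  have hbc' : ⁅b, c⁆ = z ^ 2 := by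
    rw [commutatorElement_def, bi, inv_of hc]
    have h : b * c = d * z := by rw [hc', ← mul_assoc, ← mul_assoc, hb, one_mul]
    rw [mul_assoc (b * c), h, mul_assoc, ← mul_assoc z, (hz d).eq, mul_assoc d z, ← mul_assoc d d,
      hd, one_mul, pow_two]
  have e2 : a * b * a = z ^ 2 * b := by
    rw [hbc', commutatorElement_def, ai, bi] at hbc
    have : a * b * a * b = z ^ 2 := by
      rw [eq_inv_of_mul_eq_one_left hbc, inv_eq_iff_mul_eq_one, ← pow_add, z4]
    rw [← this, mul_assoc _ b b, hb, mul_one]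
  have e3 : a * d * a * b * (a * d * a) = z ^ 2 * b := by
    calc a * d * a * b * (a * d * a) = a * (d * (a * b * a) * d) * a := by simp only [mul_assoc]
      _ = z ^ 2 * (a * (d * b * d) * a) := by
        rw [e2, ← mul_assoc d, ← zc]; simp only [← mul_assoc]; rw [← zc]
      _ = z ^ 2 * z ^ 2 * (a * b * a) := by
        rw [e1, ← mul_assoc a, ← zc]; simp only [mul_assoc]
      _ = z ^ 2 * b := by rw [e2, ← pow_add, z4, one_mul]
  have hε : a * d * a * (a * d * a) = 1 := by
    rw [mul_assoc, ← mul_assoc a (a * d), ← mul_assoc a, ha, one_mul, ← mul_assoc, mul_assoc a, hd,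
      mul_one, ha]
  have one_mem : ∀ {x : Q} {S : Set Q}, x * x = 1 → x * x ∈ Subgroup.closure S :=
    fun h => h ▸ Subgroup.one_mem _
  have zmem : ∀ {S : Set Q}, z ∈ S → ∀ x, x * z * x⁻¹ ∈ Subgroup.closure S := fun h x => by
    rw [← (hz x).eq, mul_inv_cancel_right]; exact Subgroup.subset_closure h
  have zbmem : ∀ {S : Set Q}, z ∈ S → b ∈ S → z ^ 2 * b ∈ Subgroup.closure S := fun h h' =>
    mul_mem (pow_mem (Subgroup.subset_closure h) 2) (Subgroup.subset_closure h')
  have s1 := encard_closure_singleton_le (by norm_num) z4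
  have s2 := card_closure_insert_le (x := b) s1 (one_mem hb) (by
    intro s hs; rw [Set.mem_singleton_iff.1 hs]; exact zmem (Set.mem_singleton z) b)
  have s3 := card_closure_insert_le (x := d) s2 (one_mem hd) (by
    rintro _ (rfl | rfl)
    · rw [di, e1]; exact zbmem (by simp) (by simp)
    · exact zmem (by simp) d)
  have s4 := card_closure_insert_le (x := a * d * a) s3 (one_mem hε) (by
    rintro _ (rfl | rfl | rfl)
    · rw [← had, mul_inv_cancel_right]; exact Subgroup.subset_closure (by simp)
    · rw [inv_of hε, e3]; exact zbmem (by simp) (by simp)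
    · exact zmem (by simp) _)
  refine card_closure_insert_le (x := a) s4 (one_mem ha) ?_
  rintro _ (rfl | rfl | rfl | rfl)
  · refine Subgroup.subset_closure ?_
    have h : a * (a * d * a) * a⁻¹ = d := by
      rw [mul_inv_eq_iff_eq_mul, mul_assoc, ← mul_assoc, ha, one_mul]
    rw [h]; simp
  · rw [ai]; exact Subgroup.subset_closure (by simp)
  · rw [ai, e2]; exact zbmem (by simp) (by simp)
  · exact zmem (by simp) _

end Relations

/-- Extended cardinality gives finiteness of `G/C` together with the bound. -/
theorem encard_quotient_C_le : (Set.univ : Set (G ⧸ C)).encard ≤ (64 : ℕ) := by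
  have h := encard_closure_le_of_central (a := (a : G ⧸ C)) (b := β) (c := γ) (d := δ)
    (congrArg _ a_mul_a) (congrArg _ β_mul_β) (congrArg _ γ_mul_γ) (congrArg _ δ_mul_δ)
    (mk_commute_of_mem_K KG_le_C βγδ_mem_K)
    ((QuotientGroup.eq_one_iff _).2
      ((le_sup_right : _ ≤ C) (Subgroup.subset_closure (Set.mem_singleton _))))
    (congrArg _ commute_δ_conj)
  convert h
  symm
  rw [← Subgroup.coe_top, SetLike.coe_set_eq]
  have ht : (Subgroup.closure {(a : G ⧸ C), (a : G ⧸ C) * δ * a, (δ : G ⧸ C), (β : G ⧸ C),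
      (β : G ⧸ C) * γ * δ}).comap (QuotientGroup.mk' C) = ⊤ := by
    have ma : a ∈ (Subgroup.closure {(a : G ⧸ C), (a : G ⧸ C) * δ * a, (δ : G ⧸ C), (β : G ⧸ C),
      (β : G ⧸ C) * γ * δ}).comap (QuotientGroup.mk' C) := Subgroup.subset_closure (by simp)
    have mb : β ∈ (Subgroup.closure {(a : G ⧸ C), (a : G ⧸ C) * δ * a, (δ : G ⧸ C), (β : G ⧸ C),
      (β : G ⧸ C) * γ * δ}).comap (QuotientGroup.mk' C) := Subgroup.subset_closure (by simp)
    have md : δ ∈ (Subgroup.closure {(a : G ⧸ C), (a : G ⧸ C) * δ * a, (δ : G ⧸ C), (β : G ⧸ C),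
      (β : G ⧸ C) * γ * δ}).comap (QuotientGroup.mk' C) := Subgroup.subset_closure (by simp)
    have mz : β * γ * δ ∈ (Subgroup.closure {(a : G ⧸ C), (a : G ⧸ C) * δ * a, (δ : G ⧸ C),
      (β : G ⧸ C), (β : G ⧸ C) * γ * δ}).comap (QuotientGroup.mk' C) :=
      Subgroup.subset_closure (by simp)
    refine subgroup_eq_top fun s => ?_
    cases s
    · exact ma
    · exact mb
    · have := mul_mem (mul_mem (inv_mem mb) mz) (inv_mem md)
      rwa [mul_assoc β, inv_mul_cancel_left, mul_inv_cancel_right] at this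
    · exact md
  refine eq_top_iff.2 fun x _ => ?_
  obtain ⟨g, rfl⟩ := QuotientGroup.mk_surjective x
  exact (ht ▸ Subgroup.mem_top g : g ∈ Subgroup.comap _ _)

instance finite_quotient_C : Finite (G ⧸ C) :=
  Set.finite_univ_iff.1 (Set.finite_of_encard_le_coe encard_quotient_C_le)

instance C_finiteIndex : C.FiniteIndex := Subgroup.finiteIndex_of_finite_quotient

theorem index_C : C.index = 64 := by
  refine le_antisymm ?_ (Nat.le_of_dvd (Nat.pos_of_ne_zero Subgroup.FiniteIndex.index_ne_zero)
    dvd_index_C)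
  have h := encard_quotient_C_le
  rw [← Set.Finite.cast_ncard_eq Set.finite_univ, Set.ncard_univ] at h
  exact_mod_cast h

/-! ### Normal subgroups contain `X^n * C` -/

theorem exists_translate_mem_K (v : List Bool) {x : G} (hx : x ∈ K) :
    ∃ y ∈ K, (y : TreeAut) = translate v x := by
  induction v with
  | nil => exact ⟨x, hx, (translate_nil _).symm⟩
  | cons b v ih =>
    obtain ⟨y, hy, e⟩ := ih
    obtain ⟨z, hz, e'⟩ := (mem_map_subtype_translate b).2 (K_le_below_K hy)
    refine ⟨z, hz, ?_⟩
    rw [← List.singleton_append, translate_append, ← e]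
    exact e'

/-- That `x` is in `K` ensures that all intermediate translates of `x` belong to `G`, as membership
in `below` demands. -/
theorem mem_iterate_below_of_translate {N : Subgroup G} [hN : N.Normal] (v : List Bool) {x : G}
    (hx : x ∈ K) (h : translate v x ∈ N.map G.subtype) : x ∈ below^[v.length] N := by
  induction v generalizing N with
  | nil =>
    rw [translate_nil] at h
    obtain ⟨y, hy, e⟩ := h
    exact Subtype.ext e ▸ hy
  | cons b v ih =>
    rw [List.length_cons, Function.iterate_succ_apply]
    refine ih ?_
    obtain ⟨y, hy, e⟩ := exists_translate_mem_K v hx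
    rw [← List.singleton_append, translate_append, ← e, mem_map_subtype_translate] at h
    exact ⟨y, h, e⟩

theorem translate_mem_of_mem_iterate_below {N : Subgroup G} [hN : N.Normal] (v : List Bool) {x : G}
    (h : x ∈ below^[v.length] N) : translate v x ∈ N.map G.subtype := by
  induction v generalizing N with
  | nil => rw [translate_nil]; exact ⟨x, h, rfl⟩
  | cons b v ih =>
    rw [List.length_cons, Function.iterate_succ_apply] at h
    obtain ⟨y, hy, e⟩ := ih h
    rw [← List.singleton_append, translate_append, ← e]
    exact (mem_map_subtype_translate b).2 hy

/-- A nontrivial element of `G` fixes some vertex at which its section exchanges the two maximal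
subtrees. -/
theorem exists_section_swaps (u : List Bool) (g : G) (h : (g : TreeAut) u ≠ u) :
    ∃ (v : List Bool) (k p q : G), (∀ t, (g : TreeAut) (v ++ t) = v ++ (k : TreeAut) t) ∧
      (k : TreeAut) = pair p q * Gen.a.toAut := by
  induction u generalizing g with
  | nil =>
    obtain ⟨g₀, g₁, e | e⟩ := exists_pair g
    · rw [e, pair_apply_nil] at h; exact absurd rfl h
    · exact ⟨[], g, g₀, g₁, fun t => rfl, e⟩
  | cons x u ih =>
    obtain ⟨g₀, g₁, e | e⟩ := exists_pair g
    · cases x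
      · rw [e, pair_apply_false] at h
        obtain ⟨v, k, p, q, hv, hk⟩ := ih g₀ fun h' => h (congrArg _ h')
        refine ⟨false :: v, k, p, q, fun t => ?_, hk⟩
        rw [e, List.cons_append, pair_apply_false, hv]; rfl
      · rw [e, pair_apply_true] at h
        obtain ⟨v, k, p, q, hv, hk⟩ := ih g₁ fun h' => h (congrArg _ h')
        refine ⟨true :: v, k, p, q, fun t => ?_, hk⟩
        rw [e, List.cons_append, pair_apply_true, hv]; rfl
    · exact ⟨[], g, g₀, g₁, fun t => rfl, e⟩

theorem conj_translate {g k : TreeAut} {v : List Bool} (h : ∀ t, g (v ++ t) = v ++ k t)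
    (x : TreeAut) : g * translate v x * g⁻¹ = translate v (k * x * k⁻¹) := by
  rw [mul_inv_eq_iff_eq_mul]
  refine RelIso.ext fun u => ?_
  change g (translateFun v x u) = translateFun v (k * x * k⁻¹) (g u)
  by_cases hv : v <+: u
  · obtain ⟨t, rfl⟩ := hv
    rw [translateFun_append, h, h, translateFun_append]
    change v ++ k (x t) = v ++ k (x ((k⁻¹ * k) t))
    rw [inv_mul_cancel]; rfl
  · rw [translateFun_of_not v x u hv, translateFun_of_not]
    intro h'
    have : g (v ++ k⁻¹ []) <+: g u := by
      rw [h, ← RelIso.mul_apply, mul_inv_cancel]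
      simpa using h'
    exact hv ((List.prefix_append v _).trans (g.map_rel_iff.1 this))

/-- Since `k` swaps the subtrees, `[k,(x,1)]` is `(x⁻¹, *)`, and the commutator with `(y,1)` erases
the second coordinate. -/
theorem commutator_swap {k p q x y : TreeAut} (hk : k = pair p q * Gen.a.toAut) :
    ⁅⁅k, pair x 1⁆, pair y 1⁆ = pair ⁅x⁻¹, y⁆ 1 := by
  have h : ⁅k, pair x 1⁆ = pair x⁻¹ (q * x * q⁻¹) := by
    rw [commutatorElement_def, hk, mul_inv_rev, toAut_inv]
    simp only [mul_assoc, toAut_a_mul_pair_assoc, toAut_a_mul_self_assoc, pair_inv, pair_mul,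
      inv_one, mul_one, one_mul, mul_inv_cancel]
  rw [h]
  simp only [commutatorElement_def, pair_mul, pair_inv, inv_one, mul_one, mul_inv_cancel]

theorem exists_commutator_K_le {N : Subgroup G} [hN : N.Normal] (h : N ≠ ⊥) :
    ∃ n, ⁅K, K⁆ ≤ below^[n] N := by
  obtain ⟨g, hg, hg1⟩ := N.bot_or_exists_ne_one.resolve_left h
  obtain ⟨u, hu⟩ : ∃ u, (g : TreeAut) u ≠ u := by
    by_contra! hu
    exact hg1 (Subtype.ext (RelIso.ext hu))
  obtain ⟨v, k, p, q, hv, hk⟩ := exists_section_swaps u g hu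
  refine ⟨(v ++ [false]).length, Subgroup.commutator_le.2 fun x hx y hy => ?_⟩
  refine mem_iterate_below_of_translate (v ++ [false])
    (Subgroup.commutator_le_left K K (Subgroup.commutator_mem_commutator hx hy)) ?_
  -- The inverse of `x` is taken because `commutator_swap` inverts it once more, leaving `[x,y]`.
  obtain ⟨x', -, ex⟩ := exists_translate_mem_K (v ++ [false]) (K.inv_mem hx)
  obtain ⟨y', -, ey⟩ := exists_translate_mem_K (v ++ [false]) hy
  refine ⟨⁅⁅g, x'⁆, y'⁆, ?_, ?_⟩
  · have hc : ∀ {n : G}, n ∈ N → ∀ z, ⁅n, z⁆ ∈ N := fun {n} hn z => by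
      have e : ⁅n, z⁆ = n * (z * n⁻¹ * z⁻¹) := by rw [commutatorElement_def]; group
      exact e ▸ mul_mem hn (hN.conj_mem _ (inv_mem hn) z)
    exact hc (hc hg x') y'
  · have e : ((⁅⁅g, x'⁆, y'⁆ : G) : TreeAut) =
        ⁅⁅(g : TreeAut), (x' : TreeAut)⁆, (y' : TreeAut)⁆ := rfl
    have e1 : ⁅(g : TreeAut), translate v (pair (x⁻¹ : G) 1)⁆ =
        translate v ⁅(k : TreeAut), pair (x⁻¹ : G) 1⁆ := by
      rw [commutatorElement_def, conj_translate hv, ← map_inv, ← map_mul]; rfl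
    rw [Subgroup.subtype_apply, e, ex, ey, translate_append, translate_append, translate_append,
      translate_false, translate_false, translate_false, e1, ← map_commutatorElement,
      commutator_swap hk]
    congr 2

theorem C_le_iterate_below_commutator_K : C ≤ below^[4] ⁅K, K⁆ := C_le_below_commutator_K

theorem iterate_below_mono (n : ℕ) {D D' : Subgroup G} (h : D ≤ D') :
    below^[n] D ≤ below^[n] D' := by
  induction n generalizing D D' with
  | zero => exact h
  | succ n ih => exact ih (below_mono h)

theorem levelProd_le {N : Subgroup G} [N.Normal] {n : ℕ} {D : Subgroup G}
    (h : D ≤ below^[n] N) : levelProd n (D.map G.subtype) ≤ N.map G.subtype := by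
  refine iSup₂_le fun v hv => ?_
  rw [Subgroup.map_map]
  rintro _ ⟨x, hx, rfl⟩
  exact translate_mem_of_mem_iterate_below v (hv ▸ h hx)

theorem exists_XC_le {N : Subgroup G} [N.Normal] (h : N ≠ ⊥) :
    ∃ n, XC n ≤ N.map G.subtype := by
  obtain ⟨n, hn⟩ := exists_commutator_K_le h
  -- Four levels lead from `C` to `[K,K]`, and `n` more to `N`.
  refine ⟨4 + n, levelProd_le ?_⟩
  rw [Function.iterate_add_apply]
  exact C_le_iterate_below_commutator_K.trans (iterate_below_mono 4 hn)

/-! ### The subgroups `X^n * C` -/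

/-- The subgroup `X * H`. -/
def branch (H : Subgroup TreeAut) : Subgroup TreeAut := (H.prod H).map pairHom

theorem mem_branch {H : Subgroup TreeAut} {g : TreeAut} :
    g ∈ branch H ↔ ∃ x ∈ H, ∃ y ∈ H, pair x y = g := by
  simp only [branch, Subgroup.mem_map, Prod.exists, Subgroup.mem_prod, pair]
  tauto

theorem levelProd_zero (H : Subgroup TreeAut) : levelProd 0 H = H := by
  have : translate [] = MonoidHom.id TreeAut := MonoidHom.ext translate_nil
  simp [levelProd, List.length_eq_zero_iff, this]

theorem levelProd_succ (n : ℕ) (H : Subgroup TreeAut) :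
    levelProd (n + 1) H = branch (levelProd n H) := by
  have hcons : ∀ (b : Bool) (v : List Bool),
      translate (b :: v) = (translate [b]).comp (translate v) := fun b v =>
    MonoidHom.ext fun x => translate_append [b] v x
  refine le_antisymm (iSup₂_le fun v hv => ?_) ?_
  · obtain ⟨b, v, rfl⟩ := List.exists_cons_of_length_eq_add_one hv
    rw [hcons]
    rintro _ ⟨x, hx, rfl⟩
    have hx' : translate v x ∈ levelProd n H :=
      (le_iSup₂ (f := fun (v : List Bool) (_ : v.length = n) => H.map (translate v)) v
        (by simpa using hv)) ⟨x, hx, rfl⟩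
    cases b
    · exact mem_branch.2 ⟨_, hx', 1, one_mem _, (translate_false _).symm⟩
    · exact mem_branch.2 ⟨1, one_mem _, _, hx', (translate_true _).symm⟩
  · have key : ∀ b : Bool, levelProd n H ≤ (levelProd (n + 1) H).comap (translate [b]) := by
      refine fun b => iSup₂_le fun v hv => ?_
      rw [← Subgroup.map_le_iff_le_comap, Subgroup.map_map, ← hcons]
      exact le_iSup₂ (f := fun (v : List Bool) (_ : v.length = n + 1) => H.map (translate v))
        (b :: v) (by simp [hv])
    intro g hg
    obtain ⟨x, hx, y, hy, rfl⟩ := mem_branch.1 hg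
    exact mul_mem (key false hx) (key true hy)

theorem XC_zero : XC 0 = C.map G.subtype := levelProd_zero _

theorem XC_succ (n : ℕ) : XC (n + 1) = branch (XC n) := levelProd_succ n _

theorem branch_mono {H H' : Subgroup TreeAut} (h : H ≤ H') : branch H ≤ branch H' :=
  Subgroup.map_mono (Subgroup.prod_mono h h)

theorem branch_map_C_le : branch (C.map G.subtype) ≤ C.map G.subtype := by
  have hC : C ≤ below C := C_le_below_KG.trans (below_mono KG_le_C)
  intro g hg
  obtain ⟨_, ⟨x, hx, rfl⟩, _, ⟨y, hy, rfl⟩, rfl⟩ := mem_branch.1 hg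
  exact mul_mem ((mem_map_subtype_translate false).2 (hC hx))
    ((mem_map_subtype_translate true).2 (hC hy))

theorem XC_succ_le (n : ℕ) : XC (n + 1) ≤ XC n := by
  induction n with
  | zero => rw [XC_succ, XC_zero]; exact branch_map_C_le
  | succ n ih =>
    exact (XC_succ (n + 1)).trans_le ((branch_mono ih).trans_eq (XC_succ n).symm)

theorem XC_antitone : Antitone XC := antitone_nat_of_succ_le XC_succ_le

theorem XC_le_map_C (n : ℕ) : XC n ≤ C.map G.subtype := XC_zero ▸ XC_antitone n.zero_le

theorem map_subtype_le (D : Subgroup G) : D.map G.subtype ≤ G := by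
  rintro _ ⟨x, -, rfl⟩
  exact x.2

theorem XC_le (n : ℕ) : XC n ≤ G := (XC_le_map_C n).trans (map_subtype_le C)

theorem branch_normal (D : Subgroup G) [hD : D.Normal] :
    ((branch (D.map G.subtype)).subgroupOf G).Normal := by
  refine ⟨fun x hx g => ?_⟩
  rw [Subgroup.mem_subgroupOf] at hx ⊢
  obtain ⟨_, ⟨x₀, h₀, rfl⟩, _, ⟨x₁, h₁, rfl⟩, e⟩ := mem_branch.1 hx
  obtain ⟨g₀, g₁, e' | e'⟩ := exists_pair g
  · refine mem_branch.2 ⟨_, ⟨_, hD.conj_mem _ h₀ g₀, rfl⟩, _, ⟨_, hD.conj_mem _ h₁ g₁, rfl⟩, ?_⟩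
    rw [G.coe_mul, G.coe_mul, G.coe_inv, ← e, e', pair_inv, pair_mul, pair_mul]; rfl
  · refine mem_branch.2 ⟨_, ⟨_, hD.conj_mem _ h₁ g₀, rfl⟩, _, ⟨_, hD.conj_mem _ h₀ g₁, rfl⟩, ?_⟩
    rw [G.coe_mul, G.coe_mul, G.coe_inv, ← e, e', mul_inv_rev, toAut_inv, pair_inv]
    simp only [map_mul, map_inv, mul_assoc, Subgroup.subtype_apply, toAut_a_mul_pair_assoc,
      toAut_a_mul_self_assoc, pair_mul]

theorem branch_finiteIndex (D : Subgroup G) [D.Normal] [D.FiniteIndex] :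
    ((branch (D.map G.subtype)).subgroupOf G).FiniteIndex := by
  classical
  set S := (branch (D.map G.subtype)).subgroupOf G with hS
  choose s₀ s₁ hs using exists_pair
  -- A coset is determined by whether the chosen decomposition involves `a` and by the classes of
  -- both coordinates modulo `D`.
  let f : G → Prop × (G ⧸ D) × (G ⧸ D) :=
    fun g => ((g : TreeAut) = pair (s₀ g) (s₁ g), s₀ g, s₁ g)
  have hf : ∀ g h, f g = f h → g⁻¹ * h ∈ S := by
    intro g h e
    obtain ⟨e1, e2⟩ := Prod.ext_iff.1 e
    obtain ⟨e2, e3⟩ := Prod.ext_iff.1 e2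
    have e2' := QuotientGroup.eq.1 e2
    have e3' := QuotientGroup.eq.1 e3
    rw [hS, Subgroup.mem_subgroupOf, G.coe_mul, G.coe_inv]
    by_cases hg : (g : TreeAut) = pair (s₀ g) (s₁ g)
    · have hh : (h : TreeAut) = pair (s₀ h) (s₁ h) := by
        have : ((g : TreeAut) = pair (s₀ g) (s₁ g)) = ((h : TreeAut) = pair (s₀ h) (s₁ h)) := e1
        exact this ▸ hg
      refine mem_branch.2 ⟨_, ⟨_, e2', rfl⟩, _, ⟨_, e3', rfl⟩, ?_⟩
      rw [hg, hh, pair_inv, pair_mul]; rfl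
    · have hh : ¬ (h : TreeAut) = pair (s₀ h) (s₁ h) := by
        have : ((g : TreeAut) = pair (s₀ g) (s₁ g)) = ((h : TreeAut) = pair (s₀ h) (s₁ h)) := e1
        exact this ▸ hg
      refine mem_branch.2 ⟨_, ⟨_, e3', rfl⟩, _, ⟨_, e2', rfl⟩, ?_⟩
      rw [(hs g).resolve_left hg, (hs h).resolve_left hh, mul_inv_rev, toAut_inv, pair_inv,
        mul_assoc, pair_mul_assoc, toAut_a_mul_pair_assoc, toAut_a_mul_self, mul_one]; rfl
  have : Finite (G ⧸ S) := Finite.of_injective (fun x : G ⧸ S => f x.out) fun x y e => by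
    have := QuotientGroup.eq.2 (hf _ _ e)
    rwa [QuotientGroup.out_eq', QuotientGroup.out_eq'] at this
  exact Subgroup.finiteIndex_of_finite_quotient

theorem XC_normal_finiteIndex (n : ℕ) :
    ((XC n).subgroupOf G).Normal ∧ ((XC n).subgroupOf G).FiniteIndex := by
  induction n with
  | zero =>
    rw [XC_zero, Subgroup.subgroupOf, Subgroup.comap_map_eq_self_of_injective G.subtype_injective]
    exact ⟨C_normal, C_finiteIndex⟩
  | succ n ih =>
    obtain ⟨h, h'⟩ := ih
    have e : XC n = ((XC n).subgroupOf G).map G.subtype :=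
      (Subgroup.map_subgroupOf_eq_of_le (XC_le n)).symm
    rw [XC_succ, e]
    exact ⟨branch_normal _, branch_finiteIndex _⟩

/-! ### The profinite topology -/

/-- The map `x ↦ (x, 1)` is an injection of `K` into itself. It is not onto: `βγδ` moves the vertex
`10`, which every `(x, 1)` fixes. -/
theorem infinite_G : Infinite G := by
  by_contra h
  rw [not_infinite_iff_finite] at h
  choose f hf hf' using fun x : K => mem_below.1 (K_le_below_K x.2)
  have hinj : Function.Injective fun x : K => (⟨f x, hf x⟩ : K) := by
    intro x y e
    have : (f x : TreeAut) = f y := congrArg (fun z : K => ((z : G) : TreeAut)) e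
    rw [hf', hf'] at this
    exact Subtype.ext (Subtype.ext (pair_injective this).1)
  obtain ⟨x, hx⟩ := Finite.surjective_of_injective hinj ⟨_, βγδ_mem_K⟩
  have e : (f x : TreeAut) = ((β * γ * δ : G) : TreeAut) :=
    congrArg (fun z : K => ((z : G) : TreeAut)) hx
  rw [hf'] at e
  have e' := congrArg (fun g : TreeAut => g [true, false]) e
  change pair (x : G) 1 [true, false] = Gen.β.act (Gen.γ.act (Gen.δ.act [true, false])) at e'
  rw [pair_apply_true] at e'
  revert e'
  change ¬ [true, false] = _
  decide

theorem nhds_one_profiniteTopology :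
    @nhds G (profiniteTopology G) 1 =
      ⨅ n, Filter.principal ((XC n).subgroupOf G : Set G) := by
  rw [profiniteTopology, TopologicalSpace.nhds_generateFrom]
  refine le_antisymm (le_iInf fun n => ?_) (le_iInf₂ ?_)
  · obtain ⟨h, h'⟩ := XC_normal_finiteIndex n
    exact iInf₂_le _ ⟨one_mem _, (XC n).subgroupOf G, 1, h, h', by simp⟩
  · rintro s ⟨hs, N, g, hN, hN', rfl⟩
    obtain ⟨x, hx, hx'⟩ := hs
    -- A coset of `N` that contains `1` is `N` itself.
    have hg : g ∈ N := by
      have : g = x⁻¹ := eq_inv_of_mul_eq_one_left hx'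
      exact this ▸ inv_mem hx
    have hbot : N ≠ ⊥ := by
      rintro rfl
      have := infinite_G
      exact hN'.index_ne_zero (by rw [Subgroup.index_bot, Nat.card_eq_zero_of_infinite])
    obtain ⟨n, hn⟩ := exists_XC_le hbot
    refine (iInf_le _ n).trans (Filter.principal_mono.2 fun y hy => ?_)
    obtain ⟨z, hz, e⟩ := hn hy
    have hy : y ∈ N := (Subtype.ext e : z = y) ▸ hz
    exact ⟨g⁻¹ * y, mul_mem (inv_mem hg) hy, mul_inv_cancel_left g y⟩

theorem hasBasis_nhds_one :
    (@nhds G (profiniteTopology G) 1).HasBasis (fun _ : ℕ => True)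
      (fun n => ((XC n).subgroupOf G : Set G)) := by
  rw [nhds_one_profiniteTopology]
  refine Filter.hasBasis_iInf_principal (directed_of_isDirected_le fun m n h => ?_)
  exact Subgroup.comap_mono (XC_antitone h)

end TwistedTwin

theorem proposition5 :
    -- `C` has index 64 in `G`
    TwistedTwin.C.index = 64 ∧
    -- every nontrivial normal subgroup of `G` contains `X^n * C` for all sufficiently large `n`
    (∀ N : Subgroup TwistedTwin.G, N.Normal → N ≠ ⊥ →
      ∃ n₀ : ℕ, ∀ n : ℕ, n₀ ≤ n → TwistedTwin.XC n ≤ N.map TwistedTwin.G.subtype) ∧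
    -- the `X^n * C` are normal subgroups of finite index of `G`, and they form a basis of
    -- neighbourhoods of the identity for the profinite topology of `G`
    (∀ n : ℕ, TwistedTwin.XC n ≤ TwistedTwin.G ∧
      ((TwistedTwin.XC n).subgroupOf TwistedTwin.G).Normal ∧
      ((TwistedTwin.XC n).subgroupOf TwistedTwin.G).FiniteIndex) ∧
    (@nhds TwistedTwin.G (TwistedTwin.profiniteTopology TwistedTwin.G) 1).HasBasis
      (fun _ : ℕ => True)
      (fun n => ((TwistedTwin.XC n).subgroupOf TwistedTwin.G : Set TwistedTwin.G)) := by
  refine ⟨TwistedTwin.index_C, fun N hN h => ?_, fun n => ⟨TwistedTwin.XC_le n,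
    TwistedTwin.XC_normal_finiteIndex n⟩, TwistedTwin.hasBasis_nhds_one⟩
  obtain ⟨n₀, h₀⟩ := TwistedTwin.exists_XC_le h
  exact ⟨n₀, fun n hn => (TwistedTwin.XC_antitone hn).trans h₀⟩
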